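/- **Conventions.** All groups are complex linear algebraic groups with finite-dimensional rational representations. Write $\dim H$ for the dimension of a closed subgroup $H$ and $\mathfrak h$ for its Lie algebra. For $v\in\mathfrak g$ let $\xi_v(x)$ be the image of $v$ under the differential at $1$ of $g\mapsto g\cdot x$. Let $\mathcal O_{V,0}$ be the ring of germs at $0$ of holomorphic functions on $V$. Let $G$ act on $V$, let $K'\subseteq K$ be closed subgroups, and let $W'\subseteq W$ be $G$-invariant subspaces such that $K$ acts trivially on $V/W$, $K'$ acts trivially on $V/W'$, $\dim K=\dim W$ and $\dim K'=\dim W'$. The action of $K/K'$ on $W/W'$ *has a relatively open orbit* in $V/W'$ if some $K$-orbit in $V/W'$ has Zariski open linear projection onto $W/W'$. The *relative coefficient determinant* is $\det(a_{ji})$, a function on $V$, where $\xi_{v_i}\equiv\sum_j a_{ji}w_j \pmod{W'}$ for complementary bases $\{v_i\}$ to $\mathfrak k'$ in $\mathfrak k$ and $\{w_j\}$ to $W'$ in $W$; it is well defined up to a nonzero scalar. For $K=G$, $W=V$, $K'=1$, $W'=0$ it is called the *coefficient determinant* of $G$ on $V$. Let $G$ be connected with $\dim G=\dim V$. A *nonreduced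 block decomposition* of $(G,V)$ consists of $G$-invariant subspaces $0=W_0\subseteq W_1\subseteq\dots\subseteq W_k=V$ and closed normal subgroups $K_0\subseteq K_1\subseteq\dots\subseteq K_k=G$, where $K_j$ is a subgroup of finite index in $\ker(G\to GL(V/W_j))$, such that $\dim K_j=\dim W_j$ for all $j$ and, for $1\le j\le k$, the action of $K_j/K_{j-1}$ on $W_j/W_{j-1}$ has a relatively open orbit in $V/W_{j-1}$ and its relative coefficient determinant $p_j$ is nonzero. It is a *block decomposition* if moreover the $p_j$ are reduced and pairwise relatively prime in $\mathcal O_{V,0}$. $V$ is a *(nonreduced) block representation* of $G$ via $(W_j)$ if the $W_j$ together with the full kernels $K_j=\ker(G\to GL(V/W_j))$ form a (nonreduced) block decomposition. A *tower* $(\mathbf G,\mathbf V)$ consists of linear algebraic groups $\{e\}=G_0\subset G_1\subset G_2\subset\cdots$ and representations $0=V_0\subset V_1\subset V_2\subset\cdots$ of the $G_\ell$, with inclusions $(G_\ell,V_\ell)\to(G_{\ell+1},V_{\ell+1})$ that are homomorphisms of groups and representations. It has a *(nonreduced) block structure* with subspaces $W^\ell_j$ and subgroups $K^\ell_j$ $(0\le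 j\le k_\ell$, with $k_\ell\ge1$ for $\ell\ge1)$ if for every $\ell\ge0$ the representation $V_\ell$ of $G_\ell$ is a (nonreduced) block representation via $(W^\ell_j)_j$, the pair $(W^\ell_j,K^\ell_j)_j$ is a (nonreduced) block decomposition with $K^\ell_0$ finite, and, for $\ell\ge1$, the composition $(G_{\ell-1},V_{\ell-1})\to(G_\ell,V_\ell)\to(G_\ell/K^\ell_1,V_\ell/W^\ell_1)$ is an isomorphism of algebraic groups and representations. **Proposition.** Let $(\mathbf G,\mathbf V)$ be a tower such that the representation of $G_1$ on $V_1$ is a block representation and for all $\ell\ge1$: 1. $\dim G_\ell=\dim V_\ell$, and there is an invariant subspace $W_\ell\subseteq V_\ell$ with $\dim W_\ell=\dim K_\ell$, where $K_\ell$ is the connected component of the identity of $\ker(G_\ell\to GL(V_\ell/W_\ell))$. 2. The action of $K_\ell$ on $W_\ell$ has a relatively open orbit in $V_\ell$, and the relative coefficient determinant for $K_\ell$ on $W_\ell$ in $V_\ell$ is reduced and relatively prime in $\mathcal O_{V_\ell,0}$ to the coefficient determinant of $G_{\ell-1}$ on $V_{\ell-1}$, pulled back to $V_\ell$ by the projection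 along $W_\ell$. 3. The composition $(G_{\ell-1},V_{\ell-1})\to(G_\ell,V_\ell)\to(G_\ell/K_\ell,V_\ell/W_\ell)$ is an isomorphism of algebraic groups and representations. Let $\pi_\ell:G_\ell\to G_\ell/K_\ell\cong G_{\ell-1}$ and $\pi'_\ell:V_\ell\to V_\ell/W_\ell\cong V_{\ell-1}$ be the resulting projections. Then the tower has a block structure. Its decomposition at level $\ell$ is $$V_\ell=W^\ell_\ell\supseteq\dots\supseteq W^\ell_1\supseteq W^\ell_0=0,\qquad G_\ell=K^\ell_\ell\supseteq\dots\supseteq K^\ell_1\supseteq K^\ell_0,$$ where, for $\ell\ge1$, $W^\ell_1=W_\ell$, $K^\ell_1=K_\ell$, $K^\ell_0=\ker(K_\ell\to GL(V_\ell))$ and, for $2\le j\le\ell$, $W^\ell_j=(\pi'_\ell)^{-1}(W^{\ell-1}_{j-1})$ and $K^\ell_j=\pi_\ell^{-1}(K^{\ell-1}_{j-1})$. If $G_1$ on $V_1$ is only a nonreduced block representation, or if in 2 the relative coefficient determinants are not required to be reduced or relatively prime to the pulled-back coefficient determinants (all other conditions being kept), then the tower has a nonreduced block structure, with the same decomposition.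 -/

import Mathlib

open Filter Topology Matrix

noncomputable section

/-! ### Zariski topologies -/

/-- The Zariski topology on `X` whose regular functions are the elements of `A`: the sets
`{x | f x ≠ 0}`, `f ∈ A`, are a basis of open sets. -/
@[reducible] def zariskiTopology {X : Type*} (A : Subalgebra ℂ (X → ℂ)) : TopologicalSpace X :=
  TopologicalSpace.generateFrom {U | ∃ f ∈ A, U = {x | f x ≠ 0}}

/-- The polynomial functions on a complex vector space. -/
def polyFunctions (U : Type*) [AddCommGroup U] [Module ℂ U] : Subalgebra ℂ (U → ℂ) :=
  Algebra.adjoin ℂ (Set.range fun φ : Module.Dual ℂ U => (φ : U → ℂ))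

/-- Zariski open subsets of a complex vector space. -/
def IsZariskiOpen {U : Type*} [AddCommGroup U] [Module ℂ U] (S : Set U) : Prop :=
  IsOpen[zariskiTopology (polyFunctions U)] S

/-! ### Complex linear algebraic groups and their Lie algebras -/

/-- A complex linear algebraic group: a Zariski closed subgroup of some `GL_n(ℂ)`. -/
structure LinearAlgebraicGroup where
  n : ℕ
  carrier : Subgroup (GL (Fin n) ℂ)
  isClosed : ∃ S : Set (MvPolynomial (Fin n × Fin n) ℂ), ∀ g : GL (Fin n) ℂ,
    g ∈ carrier ↔ ∀ P ∈ S, MvPolynomial.eval (fun ij => (g : Matrix (Fin n) (Fin n) ℂ) ij.1 ij.2) P = 0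

namespace LinearAlgebraicGroup

instance : CoeSort LinearAlgebraicGroup Type := ⟨fun G => ↥G.carrier⟩

/-- The coordinate ring `ℂ[G]`, generated by the matrix entries of `g` and of `g⁻¹`. -/
def regular (G : LinearAlgebraicGroup) : Subalgebra ℂ (G → ℂ) :=
  Algebra.adjoin ℂ
    ({f | ∃ i j, f = fun g : G => (g : GL (Fin G.n) ℂ).val i j} ∪
     {f | ∃ i j, f = fun g : G => ((g⁻¹ : G) : GL (Fin G.n) ℂ).val i j})

/-- The Zariski topology of `G`. -/
abbrev zariski (G : LinearAlgebraicGroup) : TopologicalSpace G := zariskiTopology G.regular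

/-- `G` is connected. -/
def IsConnected (G : LinearAlgebraicGroup) : Prop := @ConnectedSpace G G.zariski

/-- `K` is the connected component of the identity of the subgroup `N` of `G`. -/
def IsIdentityComponent (G : LinearAlgebraicGroup) (K N : Subgroup G) : Prop :=
  (K : Set G) = @connectedComponentIn G G.zariski (N : Set G) 1

/-- The Lie algebra of a closed subgroup `K` of `G`, as a subspace of the Lie algebra of `G`: the
tangent vectors of `G` at `1` (the linear functionals `D` on `ℂ[G]` with
`D (f h) = f(1) D h + h(1) D f`) that kill the ideal of `K`. The Lie algebra of `G` is `G.lie ⊤`. -/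
def lie (G : LinearAlgebraicGroup) (K : Subgroup G) : Submodule ℂ (Module.Dual ℂ G.regular) where
  carrier := {D | (∀ f h : G.regular, D (f * h) = f.1 1 * D h + h.1 1 * D f) ∧
    ∀ f : G.regular, (∀ g ∈ K, f.1 g = 0) → D f = 0}
  zero_mem' := by simp
  add_mem' := by
    rintro D E ⟨hD, hD'⟩ ⟨hE, hE'⟩
    refine ⟨fun f h => ?_, fun f hf => ?_⟩
    · simp only [LinearMap.add_apply, hD, hE]; ring
    · simp [hD' f hf, hE' f hf]
  smul_mem' := by
    rintro c D ⟨hD, hD'⟩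
    refine ⟨fun f h => ?_, fun f hf => ?_⟩
    · simp only [LinearMap.smul_apply, hD, smul_eq_mul]; ring
    · simp [hD' f hf]

/-- The dimension of a closed subgroup. -/
def dim (G : LinearAlgebraicGroup) (K : Subgroup G) : ℕ := Module.finrank ℂ (G.lie K)

end LinearAlgebraicGroup

/-! ### Rational representations -/

/-- A rational representation of `G` on `V`: the matrix coefficients are regular functions. -/
structure RationalRep (G : LinearAlgebraicGroup) (V : Type*) [AddCommGroup V] [Module ℂ V] where
  ρ : Representation ℂ G V
  rational : ∀ (φ : Module.Dual ℂ V) (x : V), (fun g : G => φ (ρ g x)) ∈ G.regular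

namespace RationalRep

section Algebraic

variable {G : LinearAlgebraicGroup} {V : Type*} [AddCommGroup V] [Module ℂ V]

/-- The matrix coefficient `g ↦ φ (g • x)`. -/
def coeff (R : RationalRep G V) (φ : Module.Dual ℂ V) (x : V) : G.regular :=
  ⟨fun g => φ (R.ρ g x), R.rational φ x⟩

/-- The representation vector field `ξ_D` on `V` of a tangent vector `D` of `G` at `1`: the value
`ξ_D x` is the image of `D` under the differential at `1` of the orbit map `g ↦ g • x`, that is,
the vector with `φ (ξ_D x) = D (g ↦ φ (g • x))` for all linear forms `φ`. -/
def vectorField [FiniteDimensional ℂ V] (R : RationalRep G V) (D : Module.Dual ℂ G.regular)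
    (x : V) : V :=
  (Module.evalEquiv ℂ V).symm
    { toFun := fun φ => D (R.coeff φ x)
      map_add' := fun φ ψ => by rw [← map_add]; rfl
      map_smul' := fun c φ => by rw [← map_smul]; rfl }

theorem apply_vectorField [FiniteDimensional ℂ V] (R : RationalRep G V)
    (D : Module.Dual ℂ G.regular) (x : V) (φ : Module.Dual ℂ V) :
    φ (R.vectorField D x) = D (R.coeff φ x) := by
  have h := (Module.evalEquiv ℂ V).apply_symm_apply
    { toFun := fun φ => D (R.coeff φ x)
      map_add' := fun φ ψ => by rw [← map_add]; rfl
      map_smul' := fun c φ => by rw [← map_smul]; rfl }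
  exact LinearMap.congr_fun h φ

/-- The subspace `W` is `G`-invariant. -/
def IsInvariant (R : RationalRep G V) (W : Submodule ℂ V) : Prop :=
  ∀ g : G, ∀ x ∈ W, R.ρ g x ∈ W

/-- The kernel of `G → GL(V / W)`, for an invariant subspace `W`. -/
def kernelMod (R : RationalRep G V) (W : Submodule ℂ V) : Subgroup G where
  carrier := {g | ∀ x, R.ρ g x - x ∈ W}
  one_mem' := by simp
  mul_mem' := by
    intro g h hg hh x
    have h1 := W.add_mem (hg (R.ρ h x)) (hh x)
    simpa [map_mul] using h1
  inv_mem' := by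
    intro g hg x
    have h1 := W.neg_mem (hg (R.ρ g⁻¹ x))
    simpa using h1

/-- `dim G = dim V`. -/
def IsEquidimensional (_R : RationalRep G V) : Prop :=
  G.dim ⊤ = Module.finrank ℂ V

/-- For invariant subspaces `W' ≤ W` and a subgroup `K` acting trivially on `V / W`: the action of
`K` on `W / W'` has a relatively open orbit in `V / W'`, that is, there is an orbit of `K` in
`V / W'` whose linear projections onto `W / W'` are Zariski open. (Any two projections of one orbit
differ by a translation.) -/
def HasRelativelyOpenOrbit (R : RationalRep G V) (K : Subgroup G) (W' W : Submodule ℂ V) : Prop :=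
  ∃ x : V, ∀ P : (V ⧸ W') →ₗ[ℂ] ↥(W.map W'.mkQ), (∀ w : ↥(W.map W'.mkQ), P w = w) →
    IsZariskiOpen (Set.range fun g : K => P (W'.mkQ (R.ρ (g : G) x)))

end Algebraic

end RationalRep

/-- `b` is a complementary basis to `N'` in `N`: a basis of a complement of `N'` in `N`. -/
def IsComplementaryBasis {M : Type*} [AddCommGroup M] [Module ℂ M] (N' N : Submodule ℂ M)
    {m : ℕ} (b : Fin m → M) : Prop :=
  LinearIndependent ℂ b ∧ Disjoint N' (Submodule.span ℂ (Set.range b)) ∧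
    N' ⊔ Submodule.span ℂ (Set.range b) = N

/-- `p` is a relative coefficient determinant for `K / K'` on `W / W'` in `V / W'`, pulled back to
`V`: for complementary bases `v` to `Lie K'` in `Lie K` and `w` to `W'` in `W` one has
`ξ_{v i} = ∑ j, a j i • w j` modulo `W'`, and `p = det a`. It is unique up to a nonzero scalar. -/
def RationalRep.IsRelCoeffDet {G : LinearAlgebraicGroup} {V : Type*} [AddCommGroup V] [Module ℂ V]
    [FiniteDimensional ℂ V] (R : RationalRep G V) (K' K : Subgroup G) (W' W : Submodule ℂ V)
    (p : V → ℂ) : Prop :=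
  ∃ (m : ℕ) (v : Fin m → Module.Dual ℂ G.regular) (w : Fin m → V)
    (a : V → Matrix (Fin m) (Fin m) ℂ),
    IsComplementaryBasis (G.lie K') (G.lie K) v ∧ IsComplementaryBasis W' W w ∧
    (∀ x i, R.vectorField (v i) x - ∑ j, a x j i • w j ∈ W') ∧
    ∀ x, p x = (a x).det

/-- `q` is a coefficient determinant for `G` acting on `V`. -/
def RationalRep.IsCoeffDet {G : LinearAlgebraicGroup} {V : Type*} [AddCommGroup V] [Module ℂ V]
    [FiniteDimensional ℂ V] (R : RationalRep G V) (q : V → ℂ) : Prop :=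
  R.IsRelCoeffDet ⊥ ⊤ ⊥ ⊤ q

/-! ### Germs of holomorphic functions -/

/-- The ring of germs at `0` of holomorphic functions on `V`. -/
def holomorphicGerms (V : Type*) [NormedAddCommGroup V] [NormedSpace ℂ V] :
    Subring (Germ (𝓝 (0 : V)) ℂ) where
  carrier := {F | ∃ f : V → ℂ, AnalyticAt ℂ f 0 ∧ (f : Germ (𝓝 (0 : V)) ℂ) = F}
  zero_mem' := ⟨0, analyticAt_const, rfl⟩
  one_mem' := ⟨1, analyticAt_const, rfl⟩
  add_mem' := by
    rintro _ _ ⟨f, hf, rfl⟩ ⟨g, hg, rfl⟩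
    exact ⟨f + g, hf.add hg, rfl⟩
  mul_mem' := by
    rintro _ _ ⟨f, hf, rfl⟩ ⟨g, hg, rfl⟩
    exact ⟨f * g, hf.mul hg, rfl⟩
  neg_mem' := by
    rintro _ ⟨f, hf, rfl⟩
    exact ⟨-f, hf.neg, rfl⟩

/-- The germ of `f` at `0` is holomorphic and reduced (square-free, in particular nonzero). -/
def IsReducedGerm {V : Type*} [NormedAddCommGroup V] [NormedSpace ℂ V] (f : V → ℂ) : Prop :=
  ∃ F : holomorphicGerms V, F.1 = (f : Germ (𝓝 (0 : V)) ℂ) ∧ Squarefree F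

/-- The germs of `f` and `h` at `0` are holomorphic and relatively prime. -/
def AreRelPrimeGerms {V : Type*} [NormedAddCommGroup V] [NormedSpace ℂ V] (f h : V → ℂ) : Prop :=
  ∃ F H : holomorphicGerms V, F.1 = (f : Germ (𝓝 (0 : V)) ℂ) ∧
    H.1 = (h : Germ (𝓝 (0 : V)) ℂ) ∧ IsRelPrime F H

/-! ### Block representations -/

namespace RationalRep

variable {G : LinearAlgebraicGroup} {V : Type*} [NormedAddCommGroup V] [NormedSpace ℂ V]
  [FiniteDimensional ℂ V]

/-- `0 = W 0 ≤ W 1 ≤ ⋯ ≤ W k = V` and `K 0 ≤ K 1 ≤ ⋯ ≤ K k = G` form a (possibly nonreduced) block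
decomposition, where `p j` is the relative coefficient determinant for `K (j+1) / K j` acting on
`W (j+1) / W j`. The group `K j` may be the kernel of `G → GL(V / W j)` or any closed normal subgroup
of `G` of finite index in this kernel (for instance its identity component). -/
structure IsNonreducedBlockDecomposition (R : RationalRep G V) (k : ℕ) (W : ℕ → Submodule ℂ V)
    (K : ℕ → Subgroup G) (p : ℕ → V → ℂ) : Prop where
  connected : G.IsConnected
  equidimensional : R.IsEquidimensional
  W_zero : W 0 = ⊥
  W_top : W k = ⊤
  W_mono : ∀ j < k, W j ≤ W (j + 1)
  W_invariant : ∀ j ≤ k, R.IsInvariant (W j)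
  K_top : K k = ⊤
  K_mono : ∀ j < k, K j ≤ K (j + 1)
  K_closed : ∀ j ≤ k, IsClosed[G.zariski] (K j : Set G)
  K_normal : ∀ j ≤ k, (K j).Normal
  K_le : ∀ j ≤ k, K j ≤ R.kernelMod (W j)
  K_finiteIndex : ∀ j ≤ k, (K j).relIndex (R.kernelMod (W j)) ≠ 0
  dim_K : ∀ j ≤ k, G.dim (K j) = Module.finrank ℂ (W j)
  openOrbit : ∀ j < k, R.HasRelativelyOpenOrbit (K (j + 1)) (W j) (W (j + 1))
  relCoeffDet : ∀ j < k, R.IsRelCoeffDet (K j) (K (j + 1)) (W j) (W (j + 1)) (p j)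
  relCoeffDet_ne : ∀ j < k, p j ≠ 0

/-- A block decomposition: moreover the relative coefficient determinants are reduced and pairwise
relatively prime. -/
structure IsBlockDecomposition (R : RationalRep G V) (k : ℕ) (W : ℕ → Submodule ℂ V)
    (K : ℕ → Subgroup G) (p : ℕ → V → ℂ) : Prop
    extends R.IsNonreducedBlockDecomposition k W K p where
  reduced : ∀ j < k, IsReducedGerm (p j)
  relPrime : ∀ i < k, ∀ j < k, i ≠ j → AreRelPrimeGerms (p i) (p j)

/-- Block representation via the subspaces `W j`; the groups are the kernels of `G → GL(V / W j)`. -/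
def IsBlockRepVia (R : RationalRep G V) (k : ℕ) (W : ℕ → Submodule ℂ V) : Prop :=
  ∃ p, R.IsBlockDecomposition k W (fun j => R.kernelMod (W j)) p

/-- Nonreduced block representation via the subspaces `W j`. -/
def IsNonreducedBlockRepVia (R : RationalRep G V) (k : ℕ) (W : ℕ → Submodule ℂ V) : Prop :=
  ∃ p, R.IsNonreducedBlockDecomposition k W (fun j => R.kernelMod (W j)) p

/-- Block representation. -/
def IsBlockRep (R : RationalRep G V) : Prop := ∃ k W, R.IsBlockRepVia k W

/-- Nonreduced block representation: the relative coefficient determinants are nonzero, but may be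
nonreduced or not relatively prime in pairs. -/
def IsNonreducedBlockRep (R : RationalRep G V) : Prop := ∃ k W, R.IsNonreducedBlockRepVia k W

end RationalRep

/-! ### Towers -/

/-- A tower of linear algebraic groups `{e} = G 0 ⊂ G 1 ⊂ ⋯` with a tower of representations
`0 = V 0 ⊂ V 1 ⊂ ⋯`. -/
structure RepTower (V : ℕ → Type*) [∀ l, NormedAddCommGroup (V l)] [∀ l, NormedSpace ℂ (V l)]
    [∀ l, FiniteDimensional ℂ (V l)] where
  G : ℕ → LinearAlgebraicGroup
  rep : ∀ l, RationalRep (G l) (V l)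
  incG : ∀ l, G l →* G (l + 1)
  incG_injective : ∀ l, Function.Injective (incG l)
  incG_regular : ∀ l, ∀ f ∈ (G (l + 1)).regular, (fun g => f (incG l g)) ∈ (G l).regular
  incV : ∀ l, V l →ₗ[ℂ] V (l + 1)
  incV_injective : ∀ l, Function.Injective (incV l)
  equivariant : ∀ l g x, incV l ((rep l).ρ g x) = (rep (l + 1)).ρ (incG l g) (incV l x)
  G_zero : Subsingleton (G 0)
  V_zero : Subsingleton (V 0)

namespace RepTower

variable {V : ℕ → Type*} [∀ l, NormedAddCommGroup (V l)] [∀ l, NormedSpace ℂ (V l)]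
  [∀ l, FiniteDimensional ℂ (V l)]

/-- The composition `(G l, V l) → (G (l+1), V (l+1)) → (G (l+1) / K, V (l+1) / W)` is an isomorphism
of algebraic groups and representations. The regular functions on `G (l+1) / K` are the right
`K`-invariant regular functions on `G (l+1)`; the last field says that the inverse on groups is a
morphism. -/
structure IsQuotientIso (T : RepTower V) (l : ℕ) (K : Subgroup (T.G (l + 1)))
    (W : Submodule ℂ (V (l + 1))) : Prop where
  normal : K.Normal
  bijectiveG : Function.Bijective fun g : T.G l => (T.incG l g : T.G (l + 1) ⧸ K)
  bijectiveV : Function.Bijective (W.mkQ ∘ₗ T.incV l)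
  regular : ∀ f ∈ (T.G l).regular, ∃ F ∈ (T.G (l + 1)).regular,
    (∀ g, ∀ h ∈ K, F (g * h) = F g) ∧ ∀ g, F (T.incG l g) = f g

/-- The projection `V (l+1) → V (l+1) / W ≃ V l` along `W`. -/
def projV (T : RepTower V) {l : ℕ} {K : Subgroup (T.G (l + 1))} {W : Submodule ℂ (V (l + 1))}
    (h : T.IsQuotientIso l K W) : V (l + 1) →ₗ[ℂ] V l :=
  (LinearEquiv.ofBijective (W.mkQ ∘ₗ T.incV l) h.bijectiveV).symm.toLinearMap ∘ₗ W.mkQ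

/-- The projection `G (l+1) → G (l+1) / K ≃ G l`. -/
def projG (T : RepTower V) {l : ℕ} {K : Subgroup (T.G (l + 1))} {W : Submodule ℂ (V (l + 1))}
    (h : T.IsQuotientIso l K W) : T.G (l + 1) →* T.G l :=
  haveI := h.normal
  (MulEquiv.ofBijective ((QuotientGroup.mk' K).comp (T.incG l))
    h.bijectiveG).symm.toMonoidHom.comp (QuotientGroup.mk' K)

/-- The subspaces `W_j^l`, `0 ≤ j ≤ l`: the preimage in `V l` of `W (l-j+1) ⊆ V (l-j+1)` under the
composed projections `V l → V (l-1) → ⋯ → V (l-j+1)` for `1 ≤ j ≤ l`, and `0` for `j = 0`. -/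
def decompW (T : RepTower V) (K : ∀ l, Subgroup (T.G l)) (W : ∀ l, Submodule ℂ (V l))
    (h : ∀ l, T.IsQuotientIso l (K (l + 1)) (W (l + 1))) : ∀ l, ℕ → Submodule ℂ (V l)
  | 0, _ => ⊥
  | _ + 1, 0 => ⊥
  | l + 1, 1 => W (l + 1)
  | l + 1, j + 2 => (decompW T K W h l (j + 1)).comap (T.projV (h l))

/-- The subgroups `K_j^l`, `0 ≤ j ≤ l`: the preimage in `G l` of `K (l-j+1) ⊆ G (l-j+1)` under the
composed projections `G l → G (l-1) → ⋯ → G (l-j+1)` for `1 ≤ j ≤ l`, and the kernel of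
`K l → GL(V l)` for `j = 0 < l`. -/
def decompK (T : RepTower V) (K : ∀ l, Subgroup (T.G l)) (W : ∀ l, Submodule ℂ (V l))
    (h : ∀ l, T.IsQuotientIso l (K (l + 1)) (W (l + 1))) : ∀ l, ℕ → Subgroup (T.G l)
  | 0, _ => ⊥
  | l + 1, 0 => (T.rep (l + 1)).kernelMod ⊥ ⊓ K (l + 1)
  | l + 1, 1 => K (l + 1)
  | l + 1, j + 2 => (decompK T K W h l (j + 1)).comap (T.projG (h l))

/-- The decompositions `(W l, K l)`, with `k l` blocks, give the tower a block structure. -/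
structure IsBlockStructure (T : RepTower V) (k : ℕ → ℕ) (W : ∀ l, ℕ → Submodule ℂ (V l))
    (K : ∀ l, ℕ → Subgroup (T.G l)) : Prop where
  blockRep : ∀ l, (T.rep l).IsBlockRepVia (k l) (W l)
  decomposition : ∀ l, ∃ p, (T.rep l).IsBlockDecomposition (k l) (W l) (K l) p
  K_zero_finite : ∀ l, Finite (K l 0)
  one_le : ∀ l, 1 ≤ k (l + 1)
  quotientIso : ∀ l, T.IsQuotientIso l (K (l + 1) 1) (W (l + 1) 1)

/-- The decompositions `(W l, K l)`, with `k l` blocks, give the tower a nonreduced block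
structure. -/
structure IsNonreducedBlockStructure (T : RepTower V) (k : ℕ → ℕ)
    (W : ∀ l, ℕ → Submodule ℂ (V l)) (K : ∀ l, ℕ → Subgroup (T.G l)) : Prop where
  blockRep : ∀ l, (T.rep l).IsNonreducedBlockRepVia (k l) (W l)
  decomposition : ∀ l, ∃ p, (T.rep l).IsNonreducedBlockDecomposition (k l) (W l) (K l) p
  K_zero_finite : ∀ l, Finite (K l 0)
  one_le : ∀ l, 1 ≤ k (l + 1)
  quotientIso : ∀ l, T.IsQuotientIso l (K (l + 1) 1) (W (l + 1) 1)

end RepTower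

end

noncomputable section

/-! ### Zariski topologies -/

section Zariski

variable {X Y : Type*}

/-! Each step of the tower is a split extension: `(G (l+1), V (l+1))` projects onto `(G l, V l)`
with kernels `K` and `W`, and the tower inclusions are sections. The theorem is an induction on the
level, starting from the trivial level 0. A block decomposition below is pulled back along the
projection, and the block `(K, W)` is added at the bottom
(`SplitExtension.isNonreducedBlockDecomposition`). The section splits everything in sight: the Lie
algebra of the preimage of `L` is `Lie K ⊕ Lie L` (`lie_comap`), the preimage of `W'` is `W ⊕ W'`,
and open orbits and relative coefficient determinants of the old blocks are carried over unchanged.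

In bases adapted to the splitting the coefficient matrix of `G (l+1)` is block triangular, so its
coefficient determinant is, up to a scalar, the new relative determinant times the old coefficient
determinant pulled back (`isCoeffDet_mul`). Hence by induction every relative determinant divides
the coefficient determinant of its level (`germDvd_decompDet`), and the new one, being prime to the
pulled-back coefficient determinant, is prime to all the old ones. Pullback along a projection with
a section preserves square-free and relatively prime germs.

In the nonreduced case the nonvanishing of the new determinant has to come from the open orbit. This
is generic smoothness in characteristic zero: coordinates on an open orbit are algebraically
independent functions on `K`, so some point of `K` has tangent vectors dual to them
(`exists_pointDerivation_of_algebraicIndependent`), and translation to `1` gives independent values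
of vector fields (`exists_linearIndependent_vectorField`).

Identity components, full kernels and extensions by finite groups may be exchanged because a closed
subgroup of finite index has the same Lie algebra (`lie_eq_of_relIndex_ne_zero`). The bottom group
is finite since its Lie algebra vanishes (`finite_of_lie_eq_bot`). -/

/-- The generating sets form a basis because `A` is closed under products. -/
theorem exists_regular_of_isOpen_zariski {A : Subalgebra ℂ (X → ℂ)} {U : Set X}
    (hU : IsOpen[zariskiTopology A] U) {x : X} (hx : x ∈ U) :
    ∃ f ∈ A, f x ≠ 0 ∧ ∀ y, f y ≠ 0 → y ∈ U := by
  induction hU with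
  | basic s hs =>
    obtain ⟨f, hf, rfl⟩ := hs
    exact ⟨f, hf, hx, fun y hy => hy⟩
  | univ => exact ⟨1, A.one_mem, by simp, fun y _ => trivial⟩
  | inter s t _ _ ihs iht =>
    obtain ⟨f, hf, hfx, hfs⟩ := ihs hx.1
    obtain ⟨g, hg, hgx, hgt⟩ := iht hx.2
    exact ⟨f * g, A.mul_mem hf hg, mul_ne_zero hfx hgx, fun y hy =>
      ⟨hfs y (left_ne_zero_of_mul hy), hgt y (right_ne_zero_of_mul hy)⟩⟩
  | sUnion S _ ih =>
    obtain ⟨s, hs, hxs⟩ := hx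
    obtain ⟨f, hf, hfx, hfs⟩ := ih s hs hxs
    exact ⟨f, hf, hfx, fun y hy => ⟨s, hs, hfs y hy⟩⟩

theorem isOpen_zariski_ne_zero {A : Subalgebra ℂ (X → ℂ)} {f : X → ℂ} (hf : f ∈ A) :
    IsOpen[zariskiTopology A] {x | f x ≠ 0} :=
  TopologicalSpace.isOpen_generateFrom_of_mem ⟨f, hf, rfl⟩

theorem isClosed_zariski_eq_zero {A : Subalgebra ℂ (X → ℂ)} {f : X → ℂ} (hf : f ∈ A) :
    IsClosed[zariskiTopology A] {x | f x = 0} :=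
  (@isOpen_compl_iff _ _ (zariskiTopology A)).1 (isOpen_zariski_ne_zero hf)

theorem continuous_zariski {A : Subalgebra ℂ (X → ℂ)} {B : Subalgebra ℂ (Y → ℂ)} {φ : X → Y}
    (h : ∀ f ∈ B, (fun x => f (φ x)) ∈ A) :
    @Continuous X Y (zariskiTopology A) (zariskiTopology B) φ := by
  refine @Continuous.mk _ _ (zariskiTopology A) (zariskiTopology B) _ fun U hU => ?_
  induction hU with
  | basic s hs =>
    obtain ⟨f, hf, rfl⟩ := hs
    exact isOpen_zariski_ne_zero (h f hf)
  | univ => exact @isOpen_univ _ (zariskiTopology A)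
  | inter s t _ _ ihs iht => exact @IsOpen.inter _ (zariskiTopology A) _ _ ihs iht
  | sUnion S _ ih =>
    rw [Set.preimage_sUnion]
    exact @isOpen_biUnion _ _ (zariskiTopology A) _ _ ih

theorem noetherianSpace_zariski (A : Subalgebra ℂ (X → ℂ)) [IsNoetherianRing A] :
    @TopologicalSpace.NoetherianSpace X (zariskiTopology A) := by
  let := zariskiTopology A
  -- Functions vanishing off `U`: these ideals grow strictly with `U`, so ascending chains of open
  -- sets stop.
  let I : TopologicalSpace.Opens X → Ideal A := fun U =>
    { carrier := {f | ∀ x, x ∉ U → f.1 x = 0}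
      zero_mem' := by simp
      add_mem' := by
        intro f g hf hg x hx
        simp [hf x hx, hg x hx]
      smul_mem' := by
        intro c f hf x hx
        simp [hf x hx] }
  have hI : StrictMono I := by
    refine Monotone.strictMono_of_injective (fun U U' h f hf x hx => hf x fun h' => hx (h h')) ?_
    have key : ∀ U U', I U = I U' → U ≤ U' := by
      intro U U' h x hx
      by_contra hx'
      obtain ⟨f, hf, hfx, hfU⟩ := exists_regular_of_isOpen_zariski U.2 hx
      have : (⟨f, hf⟩ : A) ∈ I U' := h ▸ fun y hy => by
        by_contra h0
        exact hy (hfU y h0)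
      exact hfx (this x hx')
    exact fun U U' h => le_antisymm (key _ _ h) (key _ _ h.symm)
  exact hI.wellFoundedGT

end Zariski

/-! ### Algebraic groups -/

namespace LinearAlgebraicGroup

variable {G H : LinearAlgebraicGroup}

theorem regular_fg (G : LinearAlgebraicGroup) : G.regular.FG := by
  refine (Subalgebra.fg_def).2 ⟨_, ?_, rfl⟩
  refine Set.Finite.union ?_ ?_
  · refine (Set.finite_range fun p : Fin G.n × Fin G.n =>
      fun g : G => (g : GL (Fin G.n) ℂ).val p.1 p.2).subset ?_
    rintro f ⟨i, j, rfl⟩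
    exact ⟨(i, j), rfl⟩
  · refine (Set.finite_range fun p : Fin G.n × Fin G.n =>
      fun g : G => ((g⁻¹ : G) : GL (Fin G.n) ℂ).val p.1 p.2).subset ?_
    rintro f ⟨i, j, rfl⟩
    exact ⟨(i, j), rfl⟩

instance : Algebra.FiniteType ℂ G.regular := G.regular.fg_iff_finiteType.1 G.regular_fg

instance : IsNoetherianRing G.regular := Algebra.FiniteType.isNoetherianRing ℂ _

instance instNoetherianSpace : @TopologicalSpace.NoetherianSpace G G.zariski :=
  noetherianSpace_zariski G.regular

theorem entry_mem_regular (i j : Fin G.n) :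
    (fun g : G => (g : GL (Fin G.n) ℂ).val i j) ∈ G.regular :=
  Algebra.subset_adjoin (Or.inl ⟨i, j, rfl⟩)

theorem entry_inv_mem_regular (i j : Fin G.n) :
    (fun g : G => ((g⁻¹ : G) : GL (Fin G.n) ℂ).val i j) ∈ G.regular :=
  Algebra.subset_adjoin (Or.inr ⟨i, j, rfl⟩)

/-- A map `X → G` is a morphism if the entries of it and of its inverse are regular. -/
theorem comp_mem_of_entries {X : Type*} {A : Subalgebra ℂ (X → ℂ)} {φ : X → G}
    (h₁ : ∀ i j, (fun x => (φ x : GL (Fin G.n) ℂ).val i j) ∈ A)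
    (h₂ : ∀ i j, (fun x => (((φ x)⁻¹ : G) : GL (Fin G.n) ℂ).val i j) ∈ A)
    {f : G → ℂ} (hf : f ∈ G.regular) : (fun x => f (φ x)) ∈ A := by
  induction hf using Algebra.adjoin_induction with
  | mem f hf =>
    rcases hf with ⟨i, j, rfl⟩ | ⟨i, j, rfl⟩
    exacts [h₁ i j, h₂ i j]
  | algebraMap r => exact A.algebraMap_mem r
  | add f g _ _ hf hg => exact A.add_mem hf hg
  | mul f g _ _ hf hg => exact A.mul_mem hf hg

theorem comp_inv_mem {f : G → ℂ} (hf : f ∈ G.regular) : (fun g => f g⁻¹) ∈ G.regular :=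
  comp_mem_of_entries (φ := fun g : G => g⁻¹) entry_inv_mem_regular
    (fun i j => by simpa using entry_mem_regular i j) hf

/-- Products of morphisms into an algebraic group are morphisms. -/
theorem comp_mul_mem {X : Type*} {A : Subalgebra ℂ (X → ℂ)} {α β : X → G}
    (hα : ∀ f ∈ G.regular, (fun x => f (α x)) ∈ A) (hβ : ∀ f ∈ G.regular, (fun x => f (β x)) ∈ A)
    {f : G → ℂ} (hf : f ∈ G.regular) : (fun x => f (α x * β x)) ∈ A := by
  have key : ∀ α β : X → G, (∀ f ∈ G.regular, (fun x => f (α x)) ∈ A) →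
      (∀ f ∈ G.regular, (fun x => f (β x)) ∈ A) → ∀ i j,
      (fun x => ((α x * β x : G) : GL (Fin G.n) ℂ).val i j) ∈ A := by
    intro α β hα hβ i j
    have : (fun x => ((α x * β x : G) : GL (Fin G.n) ℂ).val i j) =
        ∑ k, (fun x => (α x : GL (Fin G.n) ℂ).val i k) * fun x => (β x : GL (Fin G.n) ℂ).val k j := by
      ext x
      simp [Matrix.mul_apply]
    rw [this]
    exact A.sum_mem fun k _ => A.mul_mem (hα _ (entry_mem_regular _ _)) (hβ _ (entry_mem_regular _ _))
  refine comp_mem_of_entries (φ := fun x => α x * β x) (key _ _ hα hβ) (fun i j => ?_) hf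
  simp only [_root_.mul_inv_rev]
  exact key _ _ (fun f hf => hβ (fun g => f g⁻¹) (comp_inv_mem hf))
    (fun f hf => hα (fun g => f g⁻¹) (comp_inv_mem hf)) i j

theorem comp_const_mem {X : Type*} {A : Subalgebra ℂ (X → ℂ)} (a : G) {f : G → ℂ} :
    (fun _ : X => f a) ∈ A := A.algebraMap_mem (f a)

theorem comp_mul_left_mem (a : G) {f : G → ℂ} (hf : f ∈ G.regular) :
    (fun g => f (a * g)) ∈ G.regular :=
  comp_mul_mem (α := fun _ => a) (β := fun g => g) (fun _ _ => comp_const_mem a)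
    (fun _ h => h) hf

theorem continuous_mul_left (a : G) : @Continuous G G G.zariski G.zariski (a * ·) :=
  continuous_zariski fun _ => comp_mul_left_mem a

/-- Regular functions separate points. -/
theorem eq_one_of_regular {g : G} (h : ∀ f ∈ G.regular, f 1 = 0 → f g = 0) : g = 1 := by
  refine Subtype.ext (Units.ext (Matrix.ext fun i j => ?_))
  have := h ((fun g : G => (g : GL (Fin G.n) ℂ).val i j) - algebraMap ℂ (G → ℂ)
    (((1 : G) : GL (Fin G.n) ℂ).val i j))
    (G.regular.sub_mem (entry_mem_regular i j) (G.regular.algebraMap_mem _)) (by simp)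
  simpa [sub_eq_zero] using this

end LinearAlgebraicGroup

namespace LinearAlgebraicGroup

variable {G H : LinearAlgebraicGroup}

/-! ### Identity components -/

theorem IsIdentityComponent.isClosed {K N : Subgroup G} (h : G.IsIdentityComponent K N)
    (hN : IsClosed[G.zariski] (N : Set G)) : IsClosed[G.zariski] (K : Set G) := by
  let := G.zariski
  have h' : (K : Set G) = connectedComponentIn (N : Set G) 1 := h
  rw [h']
  refine isClosed_of_closure_subset ?_
  have h1 : (1 : G) ∈ (N : Set G) := N.one_mem
  exact (isPreconnected_connectedComponentIn.closure).subset_connectedComponentIn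
    (subset_closure (mem_connectedComponentIn h1))
    (closure_minimal (connectedComponentIn_subset _ _) hN)

theorem IsIdentityComponent.le {K N : Subgroup G} (h : G.IsIdentityComponent K N) : K ≤ N := by
  let := G.zariski
  have h' : (K : Set G) = connectedComponentIn (N : Set G) 1 := h
  exact fun g hg => connectedComponentIn_subset (N : Set G) 1 (h' ▸ hg)

theorem IsIdentityComponent.isPreconnected {K N : Subgroup G} (h : G.IsIdentityComponent K N) :
    @IsPreconnected G G.zariski (K : Set G) := by
  let := G.zariski
  have h' : (K : Set G) = connectedComponentIn (N : Set G) 1 := h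
  rw [h']
  exact isPreconnected_connectedComponentIn

/-- `N` is a finite union of irreducible sets. Each is connected, so a translate of it through `1`
lies in `K`, and the set itself lies in one coset of `K`. -/
theorem IsIdentityComponent.relIndex_ne_zero {K N : Subgroup G} (h : G.IsIdentityComponent K N)
    (hN : IsClosed[G.zariski] (N : Set G)) : K.relIndex N ≠ 0 := by
  let := G.zariski
  have : TopologicalSpace.NoetherianSpace G := G.instNoetherianSpace
  have h' : (K : Set G) = connectedComponentIn (N : Set G) 1 := h
  obtain ⟨S, hSf, -, hSi, hSU⟩ :=
    TopologicalSpace.NoetherianSpace.exists_finite_set_isClosed_irreducible hN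
  have hSN : ∀ t ∈ S, t ⊆ (N : Set G) := fun t ht => hSU ▸ Set.subset_sUnion_of_mem ht
  have hpt : ∀ t : S, ∃ x : N, (x : G) ∈ t.1 := fun t => by
    obtain ⟨x, hx⟩ := (hSi t.1 t.2).nonempty
    exact ⟨⟨x, hSN _ t.2 hx⟩, hx⟩
  choose z hz using hpt
  have : Finite S := hSf
  have hsurj : Function.Surjective fun t : S => (z t : N ⧸ K.subgroupOf N) := by
    intro q
    obtain ⟨n, rfl⟩ := QuotientGroup.mk_surjective q
    obtain ⟨t, htS, hnt⟩ : ∃ t ∈ S, (n : G) ∈ t := by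
      have : (n : G) ∈ (N : Set G) := n.2
      rw [hSU] at this
      exact this
    refine ⟨⟨t, htS⟩, ?_⟩
    refine (QuotientGroup.eq (s := K.subgroupOf N)).2 ?_
    rw [Subgroup.mem_subgroupOf]
    have hsub : ((z ⟨t, htS⟩ : G)⁻¹ * ·) '' t ⊆ connectedComponentIn (N : Set G) 1 := by
      refine IsPreconnected.subset_connectedComponentIn ?_ ?_ ?_
      · exact (hSi t htS).isPreirreducible.isPreconnected.image _
          (continuous_mul_left (z ⟨t, htS⟩ : G)⁻¹).continuousOn
      · exact ⟨z ⟨t, htS⟩, hz ⟨t, htS⟩, by simp⟩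
      · rintro _ ⟨x, hx, rfl⟩
        exact N.mul_mem (N.inv_mem (z _).2) (hSN t htS hx)
    rw [← h'] at hsub
    exact hsub ⟨n, hnt, rfl⟩
  have := Finite.of_surjective _ hsurj
  exact (Subgroup.finiteIndex_of_finite_quotient (H := K.subgroupOf N)).index_ne_zero

/-- An extension of a connected group by a connected group that admits a section is connected. -/
theorem isConnected_of_section {K : Subgroup G} (hK : @IsPreconnected G G.zariski (K : Set G))
    (hH : H.IsConnected) (φ : H →* G) (hφ : ∀ f ∈ G.regular, (fun h => f (φ h)) ∈ H.regular)
    (hsurj : ∀ g : G, ∃ h, (φ h)⁻¹ * g ∈ K) : G.IsConnected := by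
  let := G.zariski
  let := H.zariski
  have : ConnectedSpace H := hH
  have hcont : Continuous φ := continuous_zariski hφ
  have hpre : IsPreconnected (Set.univ : Set G) := by
    refine isPreconnected_of_forall (1 : G) fun g _ => ?_
    obtain ⟨h, hh⟩ := hsurj g
    -- The coset `φ h * K` is connected, contains `g`, and meets the connected image of `φ` in `φ
    -- h`.
    refine ⟨Set.range φ ∪ (φ h * ·) '' (K : Set G), Set.subset_univ _, Or.inl ⟨1, map_one _⟩,
      Or.inr ⟨_, hh, by simp⟩, ?_⟩
    exact IsPreconnected.union (φ h) ⟨h, rfl⟩ ⟨1, K.one_mem, by simp⟩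
      (isPreconnected_range hcont) (hK.image _ (continuous_mul_left (φ h)).continuousOn)
  exact { isPreconnected_univ := hpre, toNonempty := ⟨1⟩ }

/-! ### Lie algebras -/

theorem lie_mono {K N : Subgroup G} (h : K ≤ N) : G.lie K ≤ G.lie N :=
  fun _ hD => ⟨hD.1, fun f hf => hD.2 f fun g hg => hf g (h hg)⟩

theorem apply_algebraMap_of_leibniz {D : Module.Dual ℂ G.regular}
    (hD : ∀ f h : G.regular, D (f * h) = f.1 1 * D h + h.1 1 * D f) (c : ℂ) :
    D (algebraMap ℂ _ c) = 0 := by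
  have h1 : D 1 = 0 := by
    have := hD 1 1
    simpa using this
  rw [Algebra.algebraMap_eq_smul_one, map_smul, h1, smul_zero]

/-- The matrix entry `g ↦ g i j` as a regular function. -/
def entry (i j : Fin G.n) : G.regular := ⟨_, entry_mem_regular i j⟩

/-- The matrix entry `g ↦ (g⁻¹) i j` as a regular function. -/
def entryInv (i j : Fin G.n) : G.regular := ⟨_, entry_inv_mem_regular i j⟩

/-- By the Leibniz rule a tangent vector is determined on the generators of the coordinate ring.
This also makes Lie algebras finite-dimensional. -/
theorem ext_of_leibniz {D E : Module.Dual ℂ G.regular}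
    (hD : ∀ f h : G.regular, D (f * h) = f.1 1 * D h + h.1 1 * D f)
    (hE : ∀ f h : G.regular, E (f * h) = f.1 1 * E h + h.1 1 * E f)
    (h₁ : ∀ i j, D (entry i j) = E (entry i j))
    (h₂ : ∀ i j, D (entryInv i j) = E (entryInv i j)) : D = E := by
  ext ⟨f, hf⟩
  induction hf using Algebra.adjoin_induction with
  | mem f hf =>
    rcases hf with ⟨i, j, rfl⟩ | ⟨i, j, rfl⟩
    exacts [h₁ i j, h₂ i j]
  | algebraMap r =>
    exact (apply_algebraMap_of_leibniz hD r).trans (apply_algebraMap_of_leibniz hE r).symm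
  | add f g hf hg ihf ihg =>
    have : (⟨f + g, add_mem hf hg⟩ : G.regular) = ⟨f, hf⟩ + ⟨g, hg⟩ := rfl
    rw [this, map_add, map_add, ihf, ihg]
  | mul f g hf hg ihf ihg =>
    have : (⟨f * g, mul_mem hf hg⟩ : G.regular) = ⟨f, hf⟩ * ⟨g, hg⟩ := rfl
    rw [this, hD, hE, ihf, ihg]

instance finiteDimensional_lie (K : Subgroup G) : FiniteDimensional ℂ (G.lie K) := by
  let Φ : G.lie K →ₗ[ℂ] (Fin G.n → Fin G.n → ℂ) × (Fin G.n → Fin G.n → ℂ) :=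
    { toFun := fun D => (fun i j => D.1 (entry i j), fun i j => D.1 (entryInv i j))
      map_add' := fun _ _ => rfl
      map_smul' := fun _ _ => rfl }
  refine FiniteDimensional.of_injective Φ fun D E h => Subtype.ext ?_
  have h1 := congrArg Prod.fst h
  have h2 := congrArg Prod.snd h
  exact ext_of_leibniz D.2.1 E.2.1 (fun i j => congrFun (congrFun h1 i) j)
    (fun i j => congrFun (congrFun h2 i) j)

theorem lie_bot : G.lie ⊥ = ⊥ := by
  refine eq_bot_iff.2 fun D hD => ?_
  rw [Submodule.mem_bot]
  ext f
  have h1 := hD.2 (f - algebraMap ℂ _ (f.1 1)) fun g hg => by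
    rw [Subgroup.mem_bot.1 hg]
    simp
  rw [map_sub, apply_algebraMap_of_leibniz hD.1, sub_zero] at h1
  exact h1

/-- The cosets of `K` in `N` other than `K` form a closed set `C` missing `1`, so some regular `e`
vanishes on `C` with `e 1 ≠ 0`. If `f` vanishes on `K`, then `e * f` vanishes on `N`, and `0 = D (e
* f) = e 1 * D f`. -/
theorem lie_eq_of_relIndex_ne_zero {K N : Subgroup G} (hKN : K ≤ N)
    (hK : IsClosed[G.zariski] (K : Set G)) (hfin : K.relIndex N ≠ 0) : G.lie K = G.lie N := by
  let := G.zariski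
  refine le_antisymm (lie_mono hKN) fun D hD => ⟨hD.1, fun f hf => ?_⟩
  have : (K.subgroupOf N).FiniteIndex := ⟨hfin⟩
  let C : Set G := ⋃ q : {q : N ⧸ K.subgroupOf N // q ≠ ((1 : N) : N ⧸ K.subgroupOf N)},
    ((q.1.out : G)⁻¹ * ·) ⁻¹' (K : Set G)
  have hC : IsClosed C := isClosed_iUnion_of_finite fun q =>
    hK.preimage (continuous_mul_left _)
  have h1 : (1 : G) ∈ Cᶜ := by
    simp only [C, Set.mem_compl_iff, Set.mem_iUnion, not_exists]
    rintro ⟨q, hq⟩ h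
    refine hq ?_
    rw [← QuotientGroup.out_eq' q]
    exact QuotientGroup.eq.2 (by simpa [Subgroup.mem_subgroupOf] using h)
  obtain ⟨e, he, he1, heC⟩ := exists_regular_of_isOpen_zariski hC.isOpen_compl h1
  have hef := hD.2 (⟨e, he⟩ * f) fun g hg => by
    by_cases hgK : g ∈ K
    · simp [hf g hgK]
    · have hgC : g ∈ C := by
        refine Set.mem_iUnion.2 ⟨⟨((⟨g, hg⟩ : N) : N ⧸ K.subgroupOf N), fun h => hgK ?_⟩, ?_⟩
        · have := QuotientGroup.eq.1 h
          simpa [Subgroup.mem_subgroupOf] using this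
        · have := QuotientGroup.eq.1 (QuotientGroup.out_eq' ((⟨g, hg⟩ : N) : N ⧸ K.subgroupOf N))
          simpa [Subgroup.mem_subgroupOf] using this
      have : e g = 0 := by
        by_contra h0
        exact heC g h0 hgC
      simp [this]
  rw [hD.1, hf 1 K.one_mem, zero_mul, add_zero] at hef
  exact (mul_eq_zero.1 hef).resolve_left he1

/-- A subgroup with trivial Lie algebra is finite. -/
theorem finite_of_lie_eq_bot {K : Subgroup G} (hK : G.lie K = ⊥) : Finite K := by
  let m : Ideal G.regular :=
    { carrier := {f | f.1 1 = 0}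
      zero_mem' := rfl
      add_mem' := fun {f g} (hf : f.1 1 = 0) (hg : g.1 1 = 0) => by simp [hf, hg]
      smul_mem' := fun c f (hf : f.1 1 = 0) => by simp [hf] }
  let I : Ideal G.regular :=
    { carrier := {f | ∀ g ∈ K, f.1 g = 0}
      zero_mem' := fun _ _ => rfl
      add_mem' := fun {f g} hf hg x hx => by simp [hf x hx, hg x hx]
      smul_mem' := fun c f hf x hx => by simp [hf x hx] }
  -- Here `m` is the maximal ideal at `1` and `I` the ideal of `K`. A functional killing `I + m²`
  -- but not some `f ∈ m`, composed with `ε : f ↦ f - f 1`, would be a nonzero tangent vector of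
  -- `K`.
  have hle : m ≤ I ⊔ m • m := by
    intro f hf
    by_contra hfn
    have hfn' : f ∉ (I ⊔ m • m).restrictScalars ℂ := hfn
    obtain ⟨D, hDf, hD0⟩ := Submodule.exists_dual_map_eq_bot_of_notMem hfn' inferInstance
    have hD : ∀ x ∈ I ⊔ m • m, D x = 0 := fun x hx => by
      have : D x ∈ ((I ⊔ m • m).restrictScalars ℂ).map D := ⟨x, hx, rfl⟩
      rw [hD0] at this
      exact this
    let ε : G.regular →ₗ[ℂ] G.regular :=
      { toFun := fun f => f - algebraMap ℂ _ (f.1 1)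
        map_add' := fun f g => by
          have : (f + g).1 1 = f.1 1 + g.1 1 := rfl
          rw [this, map_add]
          abel
        map_smul' := fun c f => by
          have : (c • f).1 1 = c * f.1 1 := rfl
          rw [this, map_mul, RingHom.id_apply, smul_sub, Algebra.smul_def c (algebraMap _ _ _)] }
    have hε : ∀ f, ε f = f - algebraMap ℂ _ (f.1 1) := fun _ => rfl
    have hεm : ∀ f, ε f ∈ m := fun f => by
      change (f - algebraMap ℂ _ (f.1 1)).1 1 = 0
      simp
    have hmem : D ∘ₗ ε ∈ G.lie K := by
      refine ⟨fun f h => ?_, fun f hf => ?_⟩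
      · have h1 : ε (f * h) = ε f * ε h + f.1 1 • ε h + h.1 1 • ε f := by
          have : (f * h).1 1 = f.1 1 * h.1 1 := rfl
          simp only [hε, this, Algebra.smul_def, map_mul]
          ring
        have h2 : D (ε f * ε h) = 0 :=
          hD _ (Ideal.mem_sup_right (Ideal.mul_mem_mul (hεm f) (hεm h)))
        simp only [LinearMap.comp_apply, h1, map_add, map_smul, h2, smul_eq_mul, zero_add]
      · have : f.1 1 = 0 := hf 1 K.one_mem
        simp only [LinearMap.comp_apply, hε, this, map_zero, sub_zero]
        exact hD _ (Ideal.mem_sup_left hf)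
    rw [hK, Submodule.mem_bot] at hmem
    have := LinearMap.congr_fun hmem f
    have hf1 : f.1 1 = 0 := hf
    simp only [LinearMap.comp_apply, hε, hf1, map_zero, sub_zero, LinearMap.zero_apply] at this
    exact hDf this
  -- Nakayama: `r 1 = 1` and `r * m ⊆ I`. So `1` is the only point of `K` where `r ≠ 0`, hence
  -- isolated; translates and quasi-compactness then give finiteness.
  obtain ⟨r, hr, hrm⟩ := Submodule.exists_sub_one_mem_and_smul_le_of_fg_of_le_sup
    (IsNoetherian.noetherian m) le_rfl hle
  have hr1 : r.1 1 ≠ 0 := by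
    have : (r - 1).1 1 = 0 := hr
    have h2 : r.1 1 - 1 = 0 := this
    rw [sub_eq_zero.1 h2]
    exact one_ne_zero
  have huniq : ∀ g ∈ K, r.1 g ≠ 0 → g = 1 := by
    intro g hg hrg
    refine eq_one_of_regular fun f hf hf1 => ?_
    have : r • (⟨f, hf⟩ : G.regular) ∈ I := hrm (Submodule.smul_mem_pointwise_smul _ _ _ hf1)
    exact (mul_eq_zero.1 (this g hg)).resolve_left hrg
  let := G.zariski
  have : TopologicalSpace.NoetherianSpace G := G.instNoetherianSpace
  have hcomp : IsCompact (K : Set G) := TopologicalSpace.NoetherianSpace.isCompact _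
  obtain ⟨t, ht⟩ := hcomp.elim_finite_subcover (fun a : K => {x | r.1 ((a : G)⁻¹ * x) ≠ 0})
    (fun a => isOpen_zariski_ne_zero (comp_mul_left_mem _ r.2))
    (fun a ha => Set.mem_iUnion.2 ⟨⟨a, ha⟩, by simpa using hr1⟩)
  refine Finite.of_surjective (fun a : t => a.1) fun g => ?_
  obtain ⟨a, hat, hag⟩ := Set.mem_iUnion₂.1 (ht g.2)
  have := huniq ((a : G)⁻¹ * g) (K.mul_mem (K.inv_mem a.2) g.2) hag
  exact ⟨⟨a, hat⟩, Subtype.ext (inv_mul_eq_one.1 this)⟩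

/-! ### Functoriality of Lie algebras -/

/-- The comorphism of a morphism of varieties between algebraic groups. -/
def pullback (φ : G → H) (h : ∀ f ∈ H.regular, (fun g => f (φ g)) ∈ G.regular) :
    H.regular →ₐ[ℂ] G.regular where
  toFun f := ⟨fun g => f.1 (φ g), h f.1 f.2⟩
  map_one' := rfl
  map_mul' _ _ := rfl
  map_zero' := rfl
  map_add' _ _ := rfl
  commutes' _ := rfl

@[simp]
theorem pullback_apply (φ : G → H) (h : ∀ f ∈ H.regular, (fun g => f (φ g)) ∈ G.regular)
    (f : H.regular) (g : G) : (pullback φ h f).1 g = f.1 (φ g) := rfl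

theorem comp_pullback_mem_lie {φ : G → H}
    (h : ∀ f ∈ H.regular, (fun g => f (φ g)) ∈ G.regular) (hφ : φ 1 = 1) {K : Subgroup G}
    {L : Subgroup H} (hKL : ∀ g ∈ K, φ g ∈ L) {D : Module.Dual ℂ G.regular} (hD : D ∈ G.lie K) :
    D ∘ₗ (pullback φ h).toLinearMap ∈ H.lie L := by
  refine ⟨fun f k => ?_, fun f hf => hD.2 _ fun g hg => hf _ (hKL g hg)⟩
  have := hD.1 (pullback φ h f) (pullback φ h k)
  simp only [LinearMap.comp_apply, AlgHom.toLinearMap_apply, map_mul, this, pullback_apply, hφ]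

/-- The differential at `1` of a product of morphisms is the sum of the differentials. -/
theorem comp_pullback_mul {α β : G → H}
    (hα : ∀ f ∈ H.regular, (fun g => f (α g)) ∈ G.regular)
    (hβ : ∀ f ∈ H.regular, (fun g => f (β g)) ∈ G.regular) (hα1 : α 1 = 1) (hβ1 : β 1 = 1)
    {D : Module.Dual ℂ G.regular} (hD : D ∈ G.lie ⊤) :
    D ∘ₗ (pullback (fun g => α g * β g) fun _ => comp_mul_mem hα hβ).toLinearMap =
      D ∘ₗ (pullback α hα).toLinearMap + D ∘ₗ (pullback β hβ).toLinearMap := by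
  have e₁ := comp_pullback_mem_lie (L := ⊤) hα hα1 (fun _ _ => trivial) hD
  have e₂ := comp_pullback_mem_lie (L := ⊤) hβ hβ1 (fun _ _ => trivial) hD
  have e₃ := comp_pullback_mem_lie (φ := fun g => α g * β g) (L := ⊤) (fun _ => comp_mul_mem hα hβ)
    (by simp [hα1, hβ1]) (fun _ _ => trivial) hD
  -- It suffices to differentiate the matrix product on entries; for the entries of the inverse the
  -- two factors change places.
  refine ext_of_leibniz e₃.1 (add_mem e₁ e₂).1 (fun i j => ?_) (fun i j => ?_)
  · have h1 : pullback (fun g => α g * β g) (fun _ => comp_mul_mem hα hβ) (entry i j) =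
        ∑ k, pullback α hα (entry i k) * pullback β hβ (entry k j) := by
      ext g
      rw [AddSubmonoidClass.coe_finsetSum, Finset.sum_apply]
      exact Matrix.mul_apply
    have h2 : ∀ k, (pullback α hα (entry i k)).1 1 = (1 : Matrix _ _ ℂ) i k := fun k => by
      rw [pullback_apply, hα1]
      rfl
    have h3 : ∀ k, (pullback β hβ (entry k j)).1 1 = (1 : Matrix _ _ ℂ) k j := fun k => by
      rw [pullback_apply, hβ1]
      rfl
    simp only [LinearMap.comp_apply, AlgHom.toLinearMap_apply, h1, map_sum, hD.1,
      LinearMap.add_apply, Finset.sum_add_distrib, h2, h3, Matrix.one_apply, ite_mul, one_mul,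
      zero_mul, Finset.sum_ite_eq, Finset.sum_ite_eq', Finset.mem_univ, if_true]
    exact add_comm _ _
  · have h1 : pullback (fun g => α g * β g) (fun _ => comp_mul_mem hα hβ) (entryInv i j) =
        ∑ k, pullback β hβ (entryInv i k) * pullback α hα (entryInv k j) := by
      ext g
      rw [AddSubmonoidClass.coe_finsetSum, Finset.sum_apply]
      change (((α g * β g)⁻¹ : H) : GL (Fin H.n) ℂ).val i j = _
      rw [_root_.mul_inv_rev]
      exact Matrix.mul_apply
    have h2 : ∀ k, (pullback α hα (entryInv k j)).1 1 = (1 : Matrix _ _ ℂ) k j := fun k => by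
      rw [pullback_apply, hα1]
      exact congrFun (congrFun (congrArg (fun g : H => (g : GL (Fin H.n) ℂ).val) inv_one) k) j
    have h3 : ∀ k, (pullback β hβ (entryInv i k)).1 1 = (1 : Matrix _ _ ℂ) i k := fun k => by
      rw [pullback_apply, hβ1]
      exact congrFun (congrFun (congrArg (fun g : H => (g : GL (Fin H.n) ℂ).val) inv_one) i) k
    simp only [LinearMap.comp_apply, AlgHom.toLinearMap_apply, h1, map_sum, hD.1,
      LinearMap.add_apply, Finset.sum_add_distrib, h2, h3, Matrix.one_apply, ite_mul, one_mul,
      zero_mul, Finset.sum_ite_eq, Finset.sum_ite_eq', Finset.mem_univ, if_true]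

end LinearAlgebraicGroup

/-! ### Generic smoothness in characteristic zero -/

/-- In characteristic zero `L` is formally smooth over the fraction field of `R`, hence over `R`. So
`Ω_R ⊗ L → Ω_L` is injective, and a left inverse over the field `L` extends `d`. -/
theorem Derivation.exists_extension_of_field {R L : Type*} [CommRing R] [IsDomain R] [Field L]
    [Algebra ℂ R] [Algebra ℂ L] [Algebra R L] [IsScalarTower ℂ R L] [FaithfulSMul R L]
    [Algebra.EssFiniteType ℂ L] (d : Derivation ℂ R L) :
    ∃ D : Derivation ℂ L L, ∀ r, D (algebraMap R L r) = d r := by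
  let F := FractionRing R
  let : Algebra F L := FractionRing.liftAlgebra R L
  have : IsScalarTower ℂ F L := inferInstance
  have : Algebra.EssFiniteType F L := Algebra.EssFiniteType.of_comp ℂ F L
  have : CharZero F := charZero_of_injective_algebraMap (algebraMap ℂ F).injective
  have : Algebra.FormallySmooth F L := inferInstance
  have : Algebra.FormallySmooth R F := .of_isLocalization (nonZeroDivisors R)
  have : Algebra.FormallySmooth R L := .comp R F L
  have hinj : Function.Injective (KaehlerDifferential.mapBaseChange ℂ R L) := by
    rw [injective_iff_map_eq_zero]
    intro x hx
    -- The kernel is the image of the first cotangent homology of `L` over `R`, which vanishes by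
    -- formal smoothness.
    obtain ⟨y, rfl⟩ := (Algebra.H1Cotangent.exact_δ_mapBaseChange ℂ R L x).1 hx
    rw [Subsingleton.elim y 0, map_zero]
  obtain ⟨g, hg⟩ := LinearMap.exists_leftInverse_of_injective
    (KaehlerDifferential.mapBaseChange ℂ R L) (LinearMap.ker_eq_bot.2 hinj)
  let e := (LinearMap.liftBaseChange L d.liftKaehlerDifferential) ∘ₗ g
  refine ⟨e.compDer (KaehlerDifferential.D ℂ L), fun r => ?_⟩
  have : g (KaehlerDifferential.D ℂ L (algebraMap R L r)) =
      1 ⊗ₜ (KaehlerDifferential.D ℂ R r) := by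
    have := LinearMap.congr_fun hg (1 ⊗ₜ (KaehlerDifferential.D ℂ R r))
    simpa using this
  simp [e, this]

/-- A minimal prime of a reduced Noetherian ring is annihilated by an element outside it. -/
theorem exists_notMem_mul_eq_zero_of_minimalPrimes {A : Type*} [CommRing A] [IsNoetherianRing A]
    [IsReduced A] {p : Ideal A} (hp : p ∈ minimalPrimes A) :
    ∃ t, t ∉ p ∧ ∀ a ∈ p, t * a = 0 := by
  have hfin := minimalPrimes.finite_of_isNoetherianRing A
  have hpp : p.IsPrime := hp.1.1
  let S : Finset (Ideal A) := hfin.toFinset.erase p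
  have hS : ¬ S.inf id ≤ p := by
    rw [hpp.inf_le']
    rintro ⟨q, hq, hqp⟩
    rw [Finset.mem_erase, Set.Finite.mem_toFinset] at hq
    exact hq.1 (le_antisymm hqp (hp.2 hq.2.1 hqp))
  -- `t` lies in every other minimal prime, so `t * a` lies in all of them and is nilpotent.
  obtain ⟨t, htS, htp⟩ := SetLike.not_le_iff_exists.1 hS
  refine ⟨t, htp, fun a ha => ?_⟩
  have : t * a ∈ sInf (minimalPrimes A) := by
    rw [Submodule.mem_sInf]
    intro q hq
    by_cases hqp : q = p
    · exact hqp ▸ p.mul_mem_left t ha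
    · refine Ideal.mul_mem_right a q ?_
      have : S.inf id ≤ q := Finset.inf_le (f := id) (by simp [S, hqp, hq])
      exact this htS
  rw [minimalPrimes, Ideal.sInf_minimalPrimes] at this
  exact IsNilpotent.eq_zero (mem_nilradical.1 this)

/-- Algebraically independent elements of a field extension of `ℂ` have dual derivations. -/
theorem exists_derivation_of_algebraicIndependent_field {L : Type*} [Field L] [Algebra ℂ L]
    [Algebra.EssFiniteType ℂ L] {m : ℕ} {φ : Fin m → L} (hφ : AlgebraicIndependent ℂ φ) (i : Fin m) :
    ∃ D : Derivation ℂ L L, ∀ j, D (φ j) = if i = j then 1 else 0 := by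
  let : Algebra (MvPolynomial (Fin m) ℂ) L := (MvPolynomial.aeval φ).toRingHom.toAlgebra
  have : IsScalarTower ℂ (MvPolynomial (Fin m) ℂ) L :=
    IsScalarTower.of_algebraMap_eq fun r => ((MvPolynomial.aeval φ).commutes r).symm
  have : FaithfulSMul (MvPolynomial (Fin m) ℂ) L :=
    (faithfulSMul_iff_algebraMap_injective _ L).2 hφ
  -- Extend the partial derivative `∂/∂X i` of the polynomial ring embedded by `φ`.
  obtain ⟨D, hD⟩ := Derivation.exists_extension_of_field
    (MvPolynomial.mkDerivation ℂ (Pi.single i (1 : L)))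
  refine ⟨D, fun j => ?_⟩
  have := hD (MvPolynomial.X j)
  rw [MvPolynomial.mkDerivation_X, Pi.single_apply] at this
  have h2 : algebraMap (MvPolynomial (Fin m) ℂ) L (MvPolynomial.X j) = φ j :=
    MvPolynomial.aeval_X φ j
  rw [← h2, this]
  simp only [eq_comm]

/-- Clear denominators: `b` is a common denominator for the values of the dual derivations of the
fraction field on finitely many generators of `B`, so `b • D i` preserves `B`. -/
theorem exists_derivation_of_algebraicIndependent {B : Type*} [CommRing B] [IsDomain B]
    [Algebra ℂ B] [Algebra.FiniteType ℂ B] {m : ℕ} {φ : Fin m → B}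
    (hφ : AlgebraicIndependent ℂ φ) :
    ∃ b : B, b ≠ 0 ∧ ∃ d : Fin m → B →ₗ[ℂ] B, (∀ i f g, d i (f * g) = f * d i g + g * d i f) ∧
      ∀ i j, d i (φ j) = if i = j then b else 0 := by
  have hinjL : Function.Injective (algebraMap B (FractionRing B)) := IsFractionRing.injective B _
  have : Algebra.EssFiniteType B (FractionRing B) := .of_isLocalization _ (nonZeroDivisors B)
  have : Algebra.EssFiniteType ℂ (FractionRing B) := .comp ℂ B _
  have hφL : AlgebraicIndependent ℂ fun j => algebraMap B (FractionRing B) (φ j) :=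
    hφ.map' (f := IsScalarTower.toAlgHom ℂ B (FractionRing B)) hinjL
  choose D hD using exists_derivation_of_algebraicIndependent_field hφL
  obtain ⟨S, hS⟩ := (Algebra.FiniteType.out : (⊤ : Subalgebra ℂ B).FG)
  obtain ⟨b, hb⟩ := IsLocalization.exist_integer_multiples_of_finite (nonZeroDivisors B)
    fun q : Fin m × S => D q.1 (algebraMap B (FractionRing B) q.2.1)
  have hint : ∀ i a, ∃ c : B, algebraMap B (FractionRing B) c =
      algebraMap B _ b * D i (algebraMap B _ a) := by
    intro i a
    have ha : a ∈ Algebra.adjoin ℂ (S : Set B) := hS ▸ Algebra.mem_top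
    induction ha using Algebra.adjoin_induction with
    | mem a ha =>
      obtain ⟨c, hc⟩ := hb (i, ⟨a, ha⟩)
      exact ⟨c, by rw [hc, Algebra.smul_def]⟩
    | algebraMap r =>
      refine ⟨0, ?_⟩
      rw [← IsScalarTower.algebraMap_apply, Derivation.map_algebraMap]
      simp
    | add f g _ _ hf hg =>
      obtain ⟨c, hc⟩ := hf
      obtain ⟨c', hc'⟩ := hg
      exact ⟨c + c', by simp only [map_add, hc, hc']; ring⟩
    | mul f g _ _ hf hg =>
      obtain ⟨c, hc⟩ := hf
      obtain ⟨c', hc'⟩ := hg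
      refine ⟨f * c' + g * c, ?_⟩
      simp only [map_add, map_mul, hc, hc', Derivation.leibniz, smul_eq_mul]
      ring
  choose c hc using hint
  refine ⟨b, nonZeroDivisors.ne_zero b.2, fun i =>
    { toFun := c i
      map_add' := fun f g => hinjL (by simp only [map_add, hc]; ring)
      map_smul' := fun r f => hinjL ?_ }, fun i f g => hinjL ?_, fun i j => hinjL ?_⟩
  · rw [RingHom.id_apply, Algebra.smul_def r (c i f), map_mul, hc, hc, Algebra.smul_def, map_mul,
      Derivation.leibniz, ← IsScalarTower.algebraMap_apply, Derivation.map_algebraMap]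
    simp only [smul_eq_mul]
    ring
  · simp only [LinearMap.coe_mk, AddHom.coe_mk, map_add, map_mul, hc, Derivation.leibniz,
      smul_eq_mul]
    ring
  · simp only [LinearMap.coe_mk, AddHom.coe_mk, hc, hD]
    split_ifs <;> simp

/-- Algebraically independent functions are part of a coordinate system at some point. -/
theorem exists_pointDerivation_of_algebraicIndependent {X : Type*} (A : Subalgebra ℂ (X → ℂ))
    [Algebra.FiniteType ℂ A] {m : ℕ} {φ : Fin m → A} (hφ : AlgebraicIndependent ℂ φ) :
    ∃ (x : X) (d : Fin m → Module.Dual ℂ A),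
      (∀ i f g, d i (f * g) = f.1 x * d i g + g.1 x * d i f) ∧
      ∀ i j, d i (φ j) = if i = j then 1 else 0 := by
  have : IsNoetherianRing A := Algebra.FiniteType.isNoetherianRing ℂ A
  have : IsReduced A := isReduced_of_injective A.val Subtype.val_injective
  -- `A` need not be a domain. A component of it is chosen on which the `φ j` stay independent: a
  -- minimal prime meeting the polynomial subring only in `0`.
  obtain ⟨p, hp, hpR⟩ : ∃ p ∈ minimalPrimes A, ∀ r : MvPolynomial (Fin m) ℂ,
      MvPolynomial.aeval φ r ∈ p → r = 0 := by
    obtain ⟨p', hp', hpc⟩ := Ideal.exists_comap_eq_of_mem_minimalPrimes_of_injective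
      (f := (MvPolynomial.aeval φ : MvPolynomial (Fin m) ℂ →ₐ[ℂ] A).toRingHom) hφ ⊥ (by
        rw [IsDomain.minimalPrimes_eq_singleton_bot]; rfl)
    obtain ⟨p, hp, hpp'⟩ := Ideal.exists_minimalPrimes_le (bot_le : (⊥ : Ideal A) ≤ p')
    exact ⟨p, hp, fun r hr => hpc.le (hpp' hr)⟩
  have hpp : p.IsPrime := hp.1.1
  obtain ⟨t, htp, ht⟩ := exists_notMem_mul_eq_zero_of_minimalPrimes hp
  have hφB : AlgebraicIndependent ℂ fun j => Ideal.Quotient.mkₐ ℂ p (φ j) := by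
    rw [algebraicIndependent_iff]
    intro r hr
    refine hpR r (Ideal.Quotient.eq_zero_iff_mem.1 ?_)
    have h : (Ideal.Quotient.mkₐ ℂ p).comp (MvPolynomial.aeval φ) =
        MvPolynomial.aeval fun j => Ideal.Quotient.mkₐ ℂ p (φ j) :=
      MvPolynomial.algHom_ext fun j => by simp
    rw [← hr, ← h]
    rfl
  obtain ⟨b, hb, d, hd, hdφ⟩ := exists_derivation_of_algebraicIndependent hφB
  obtain ⟨β, rfl⟩ := Ideal.Quotient.mk_surjective b
  have hβp : β ∉ p := fun h => hb (Ideal.Quotient.eq_zero_iff_mem.2 h)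
  have htβ : t * β ≠ 0 := fun h => by
    have : t * β ∈ p := h ▸ p.zero_mem
    exact (hpp.mem_or_mem this).elim htp hβp
  -- Since `t` kills `p`, `t x ≠ 0` makes evaluation at `x` factor through `A ⧸ p`; `β x ≠ 0` allows
  -- the derivations to be normalised by `(β x)⁻¹`.
  obtain ⟨x, hx⟩ : ∃ x, t.1 x * β.1 x ≠ 0 := by
    by_contra! h
    exact htβ (Subtype.ext (funext h))
  have hβx : β.1 x ≠ 0 := right_ne_zero_of_mul hx
  have hevp : ∀ a ∈ p, a.1 x = 0 := fun a ha => by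
    have := congrFun (congrArg Subtype.val (ht a ha)) x
    exact (mul_eq_zero.1 this).resolve_left (left_ne_zero_of_mul hx)
  let ev : (A ⧸ p) →ₐ[ℂ] ℂ :=
    Ideal.Quotient.liftₐ p ((Pi.evalAlgHom ℂ (fun _ : X => ℂ) x).comp A.val) hevp
  have hev : ∀ a, ev (Ideal.Quotient.mk p a) = a.1 x := fun a => rfl
  refine ⟨x, fun i => (β.1 x)⁻¹ • (ev.toLinearMap ∘ₗ d i ∘ₗ (Ideal.Quotient.mkₐ ℂ p).toLinearMap),
    fun i f g => ?_, fun i j => ?_⟩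
  · simp only [LinearMap.smul_apply, LinearMap.comp_apply, AlgHom.toLinearMap_apply, map_mul, hd,
      map_add, Ideal.Quotient.mkₐ_eq_mk, hev, smul_eq_mul]
    ring
  · simp only [LinearMap.smul_apply, LinearMap.comp_apply, AlgHom.toLinearMap_apply, hdφ]
    split_ifs
    · rw [hev, smul_eq_mul, inv_mul_cancel₀ hβx]
    · simp

/-! ### Polynomial functions -/

theorem exists_mvPolynomial_of_mem_polyFunctions {U : Type*} [AddCommGroup U] [Module ℂ U] {m : ℕ}
    (b : Module.Basis (Fin m) ℂ U) {f : U → ℂ} (hf : f ∈ polyFunctions U) :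
    ∃ q : MvPolynomial (Fin m) ℂ, ∀ u, f u = MvPolynomial.eval (b.repr u) q := by
  induction hf using Algebra.adjoin_induction with
  | mem f hf =>
    obtain ⟨φ, rfl⟩ := hf
    refine ⟨∑ j, MvPolynomial.C (φ (b j)) * MvPolynomial.X j, fun u => ?_⟩
    have := congrArg φ (b.sum_repr u)
    rw [map_sum] at this
    refine this.symm.trans ?_
    simp [mul_comm]
  | algebraMap r => exact ⟨MvPolynomial.C r, by simp⟩
  | add f g _ _ hf hg =>
    obtain ⟨q, hq⟩ := hf
    obtain ⟨r, hr⟩ := hg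
    exact ⟨q + r, fun u => by simp [hq, hr]⟩
  | mul f g _ _ hf hg =>
    obtain ⟨q, hq⟩ := hf
    obtain ⟨r, hr⟩ := hg
    exact ⟨q * r, fun u => by simp [hq, hr]⟩

/-- A polynomial vanishing on a nonempty Zariski open set is zero. -/
theorem mvPolynomial_eq_zero_of_isZariskiOpen {U : Type*} [AddCommGroup U] [Module ℂ U] {m : ℕ}
    (b : Module.Basis (Fin m) ℂ U) {S : Set U} (hS : IsZariskiOpen S) (hne : S.Nonempty)
    {q : MvPolynomial (Fin m) ℂ} (hq : ∀ u ∈ S, MvPolynomial.eval (b.repr u) q = 0) : q = 0 := by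
  obtain ⟨u₀, hu₀⟩ := hne
  obtain ⟨f, hf, hf₀, hfS⟩ := exists_regular_of_isOpen_zariski hS hu₀
  obtain ⟨r, hr⟩ := exists_mvPolynomial_of_mem_polyFunctions b hf
  have hrq : r * q = 0 := by
    refine MvPolynomial.funext fun c => ?_
    have h := hq (b.equivFun.symm c)
    have h' := hfS (b.equivFun.symm c)
    have hc : ((b.repr (b.equivFun.symm c) : Fin m →₀ ℂ) : Fin m → ℂ) = c :=
      b.equivFun.apply_symm_apply c
    rw [hr, hc] at h'
    rw [hc] at h
    rw [map_mul, map_zero]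
    by_cases h0 : MvPolynomial.eval c r = 0
    · rw [h0, zero_mul]
    · rw [h (h' h0), mul_zero]
  refine (mul_eq_zero.1 hrq).resolve_left fun h0 => hf₀ ?_
  rw [hr, h0, map_zero]

/-! ### Rational representations -/

namespace RationalRep

variable {G : LinearAlgebraicGroup} {V : Type*} [AddCommGroup V] [Module ℂ V]

theorem mem_kernelMod {R : RationalRep G V} {W : Submodule ℂ V} {g : G} :
    g ∈ R.kernelMod W ↔ ∀ x, R.ρ g x - x ∈ W := Iff.rfl

theorem kernelMod_mono (R : RationalRep G V) {W W' : Submodule ℂ V} (h : W ≤ W') :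
    R.kernelMod W ≤ R.kernelMod W' := fun _ hg x => h (hg x)

theorem kernelMod_top (R : RationalRep G V) : R.kernelMod ⊤ = ⊤ :=
  eq_top_iff.2 fun _ _ _ => trivial

theorem isClosed_kernelMod (R : RationalRep G V) (W : Submodule ℂ V) :
    IsClosed[G.zariski] (R.kernelMod W : Set G) := by
  let := G.zariski
  have : (R.kernelMod W : Set G) = ⋂ (x : V) (φ ∈ W.dualAnnihilator),
      {g | φ (R.ρ g x) - φ x = 0} := by
    ext g
    simp only [Set.mem_iInter, Set.mem_ofPred_eq, SetLike.mem_coe, mem_kernelMod, ← map_sub]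
    exact forall_congr' fun x =>
      (Subspace.forall_mem_dualAnnihilator_apply_eq_zero_iff W _).symm
  rw [this]
  refine isClosed_iInter fun x => isClosed_iInter fun φ => isClosed_iInter fun _ => ?_
  exact isClosed_zariski_eq_zero (G.regular.sub_mem (R.rational φ x) (G.regular.algebraMap_mem (φ x)))

theorem kernelMod_normal (R : RationalRep G V) {W : Submodule ℂ V} (hW : R.IsInvariant W) :
    (R.kernelMod W).Normal := by
  refine ⟨fun n hn g x => ?_⟩
  have := hW g _ (hn (R.ρ g⁻¹ x))
  simpa [map_mul] using this

/-! ### Vector fields of a representation and coefficient determinants -/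

section VectorField

variable [FiniteDimensional ℂ V]

theorem eq_of_forall_dual {V : Type*} [AddCommGroup V] [Module ℂ V] {x y : V}
    (h : ∀ φ : Module.Dual ℂ V, φ x = φ y) : x = y :=
  sub_eq_zero.1 ((Module.forall_dual_apply_eq_zero_iff ℂ _).1 fun φ => by rw [map_sub, h, sub_self])

theorem vectorField_add (R : RationalRep G V) (D E : Module.Dual ℂ G.regular) (x : V) :
    R.vectorField (D + E) x = R.vectorField D x + R.vectorField E x :=
  eq_of_forall_dual fun φ => by simp [apply_vectorField]

theorem vectorField_smul (R : RationalRep G V) (c : ℂ) (D : Module.Dual ℂ G.regular) (x : V) :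
    R.vectorField (c • D) x = c • R.vectorField D x :=
  eq_of_forall_dual fun φ => by simp [apply_vectorField]

/-- The vector `ξ_D x` as a linear function of `D`. -/
def vectorFieldAt (R : RationalRep G V) (x : V) : Module.Dual ℂ G.regular →ₗ[ℂ] V where
  toFun D := R.vectorField D x
  map_add' D E := R.vectorField_add D E x
  map_smul' c D := R.vectorField_smul c D x

@[simp]
theorem vectorFieldAt_apply (R : RationalRep G V) (x : V) (D : Module.Dual ℂ G.regular) :
    R.vectorFieldAt x D = R.vectorField D x := rfl

theorem vectorField_mem (R : RationalRep G V) {K : Subgroup G} {W : Submodule ℂ V}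
    (hK : K ≤ R.kernelMod W) {D : Module.Dual ℂ G.regular} (hD : D ∈ G.lie K) (x : V) :
    R.vectorField D x ∈ W := by
  refine (Subspace.forall_mem_dualAnnihilator_apply_eq_zero_iff W _).1 fun φ hφ => ?_
  rw [apply_vectorField]
  have h := hD.2 (R.coeff φ x - algebraMap ℂ _ (φ x)) fun g hg => by
    have := (Submodule.mem_dualAnnihilator φ).1 hφ _ (hK hg x)
    rwa [map_sub] at this
  rwa [map_sub, LinearAlgebraicGroup.apply_algebraMap_of_leibniz hD.1, sub_zero] at h

/-- If the orbit of `K` through `x` is relatively open, then `ξ_D x`, `D ∈ Lie K`, contains as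
many independent vectors as possible. -/
theorem exists_linearIndependent_vectorField {R : RationalRep G V} {K : Subgroup G}
    {W : Submodule ℂ V} (hopen : R.HasRelativelyOpenOrbit K ⊥ W) :
    ∃ (x : V) (E : Fin (Module.finrank ℂ W) → Module.Dual ℂ G.regular), (∀ i, E i ∈ G.lie K) ∧
      LinearIndependent ℂ fun i => R.vectorField (E i) x := by
  obtain ⟨x, hx⟩ := hopen
  set U := W.map (⊥ : Submodule ℂ V).mkQ with hU
  obtain ⟨P, hP⟩ := LinearMap.exists_leftInverse_of_injective U.subtype (Submodule.ker_subtype U)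
  have hop := hx P fun w => LinearMap.congr_fun hP w
  have hfin : Module.finrank ℂ U = Module.finrank ℂ W :=
    (LinearEquiv.finrank_eq (Submodule.equivMapOfInjective _
      (LinearMap.ker_eq_bot.1 (Submodule.ker_mkQ ⊥)) W)).symm
  let b : Module.Basis (Fin (Module.finrank ℂ W)) ℂ U := Module.finBasisOfFinrankEq ℂ U hfin
  let lam : Fin (Module.finrank ℂ W) → Module.Dual ℂ V := fun j =>
    b.coord j ∘ₗ P ∘ₗ (⊥ : Submodule ℂ V).mkQ
  let res : (G → ℂ) →ₐ[ℂ] (K → ℂ) :=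
    { toFun := fun f k => f k
      map_one' := rfl
      map_mul' := fun _ _ => rfl
      map_zero' := rfl
      map_add' := fun _ _ => rfl
      commutes' := fun _ => rfl }
  let A : Subalgebra ℂ (K → ℂ) := G.regular.map res
  have : Algebra.FiniteType ℂ A := A.fg_iff_finiteType.1 (G.regular_fg.map res)
  let resA : G.regular →ₐ[ℂ] A := (res.comp G.regular.val).codRestrict A fun f => ⟨f.1, f.2, rfl⟩
  have hresA : ∀ f k, (resA f).1 k = f.1 k := fun _ _ => rfl
  let φ : Fin (Module.finrank ℂ W) → A := fun j => resA (R.coeff (lam j) x)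
  -- A relation among the coordinates of the orbit would be a polynomial vanishing on a nonempty
  -- Zariski open set.
  have hφ : AlgebraicIndependent ℂ φ := by
    rw [algebraicIndependent_iff]
    intro q hq
    refine mvPolynomial_eq_zero_of_isZariskiOpen b hop ⟨_, ⟨1, rfl⟩⟩ ?_
    rintro _ ⟨k, rfl⟩
    let ev : A →ₐ[ℂ] ℂ := (Pi.evalAlgHom ℂ (fun _ : K => ℂ) k).comp A.val
    have h1 : ev (MvPolynomial.aeval φ q) = 0 := by rw [hq, map_zero]
    have h2 : ev.comp (MvPolynomial.aeval φ) = MvPolynomial.aeval fun j => ev (φ j) :=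
      MvPolynomial.algHom_ext fun j => by simp only [AlgHom.comp_apply, MvPolynomial.aeval_X]
    rw [← AlgHom.comp_apply, h2, MvPolynomial.aeval_eq_eval] at h1
    exact h1
  obtain ⟨k, d, hd, hdφ⟩ := exists_pointDerivation_of_algebraicIndependent A hφ
  -- The dual tangent vectors sit at `k`; composing with translation by `k⁻¹` moves them to `1`. On
  -- vector fields this is undone by applying `R.ρ k`, as in `key`.
  let τ := LinearAlgebraicGroup.pullback (fun g : G => (k : G)⁻¹ * g)
    (fun f hf => LinearAlgebraicGroup.comp_mul_left_mem (k : G)⁻¹ hf)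
  refine ⟨x, fun i => d i ∘ₗ resA.toLinearMap ∘ₗ τ.toLinearMap, fun i => ⟨fun f h => ?_, fun f hf => ?_⟩, ?_⟩
  · simp only [LinearMap.comp_apply, AlgHom.toLinearMap_apply, map_mul, hd, hresA]
    simp [τ]
  · have : resA (τ f) = 0 := Subtype.ext (funext fun g => by
      exact hf _ (K.mul_mem (K.inv_mem k.2) g.2))
    simp [this]
  · have key : ∀ i j, lam j (R.ρ k (R.vectorField (d i ∘ₗ resA.toLinearMap ∘ₗ τ.toLinearMap) x)) =
        if i = j then 1 else 0 := by
      intro i j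
      rw [← hdφ i j, ← LinearMap.comp_apply, apply_vectorField]
      have : resA (τ (R.coeff (lam j ∘ₗ R.ρ k) x)) = φ j := Subtype.ext (funext fun g => by
        change lam j (R.ρ k (R.ρ ((k : G)⁻¹ * g) x)) = lam j (R.ρ g x)
        rw [← Module.End.mul_apply, ← map_mul, mul_inv_cancel_left])
      simp only [LinearMap.comp_apply, AlgHom.toLinearMap_apply, this]
    rw [Fintype.linearIndependent_iff]
    intro c hc j
    have := congrArg (fun y => lam j (R.ρ k y)) hc
    simpa only [map_sum, map_smul, key, smul_eq_mul, mul_ite, mul_one, mul_zero,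
      Finset.sum_ite_eq', Finset.sum_ite_eq, Finset.mem_univ, if_true, map_zero] using this

/-- As `dim K = dim W`, the tangent vectors with independent values at `x` are a basis of `Lie K`.
The determinant formed with this basis does not vanish at `x`. -/
theorem exists_isRelCoeffDet_ne_zero {R : RationalRep G V} {K : Subgroup G}
    {W : Submodule ℂ V} (hK : K ≤ R.kernelMod W) (hdim : G.dim K = Module.finrank ℂ W)
    (hopen : R.HasRelativelyOpenOrbit K ⊥ W) : ∃ p, R.IsRelCoeffDet ⊥ K ⊥ W p ∧ p ≠ 0 := by
  obtain ⟨x, E, hE, hind⟩ := exists_linearIndependent_vectorField hopen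
  let w := Module.finBasis ℂ W
  have hEind : LinearIndependent ℂ E := LinearIndependent.of_comp (R.vectorFieldAt x) hind
  have hEspan : Submodule.span ℂ (Set.range E) = G.lie K := by
    refine Submodule.eq_of_le_of_finrank_eq
      (Submodule.span_le.2 (by rintro _ ⟨i, rfl⟩; exact hE i)) ?_
    rw [finrank_span_eq_card hEind, Fintype.card_fin]
    exact hdim.symm
  let a : V → Matrix (Fin (Module.finrank ℂ W)) (Fin (Module.finrank ℂ W)) ℂ := fun y j i =>
    w.repr ⟨R.vectorField (E i) y, R.vectorField_mem hK (hE i) y⟩ j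
  have ha : ∀ y i, R.vectorField (E i) y = ∑ j, a y j i • (w j : V) := fun y i => by
    have := congrArg Subtype.val
      (w.sum_repr ⟨R.vectorField (E i) y, R.vectorField_mem hK (hE i) y⟩)
    rw [AddSubmonoidClass.coe_finsetSum] at this
    exact this.symm
  refine ⟨fun y => (a y).det, ⟨_, E, fun j => (w j : V), a, ⟨hEind, ?_, ?_⟩, ⟨?_, ?_, ?_⟩,
    fun y i => ?_, fun _ => rfl⟩, fun h => ?_⟩
  · rw [LinearAlgebraicGroup.lie_bot]
    exact disjoint_bot_left
  · rw [LinearAlgebraicGroup.lie_bot, bot_sup_eq, hEspan]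
  · exact w.linearIndependent.map' W.subtype (Submodule.ker_subtype W)
  · exact disjoint_bot_left
  · rw [bot_sup_eq]
    have : (Set.range fun j => (w j : V)) = W.subtype '' Set.range w := by
      rw [← Set.range_comp]; rfl
    rw [this, Submodule.span_image, w.span_eq, Submodule.map_top, Submodule.range_subtype]
  · rw [← ha, sub_self]
    exact Submodule.zero_mem _
  -- A kernel vector of `a x` would be a linear relation among the values of the vector fields at
  -- `x`.
  · obtain ⟨c, hc, hac⟩ := Matrix.exists_mulVec_eq_zero_iff.2 (congrFun h x)
    refine hc (funext (Fintype.linearIndependent_iff.1 hind c ?_))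
    simp only [ha, Finset.smul_sum, smul_smul]
    rw [Finset.sum_comm]
    refine Finset.sum_eq_zero fun j _ => ?_
    have := congrFun hac j
    rw [← Finset.sum_smul]
    simp only [mulVec, dotProduct, Pi.zero_apply] at this
    rw [Finset.sum_congr rfl fun i _ => mul_comm (c i) (a x j i), this, zero_smul]

/-- Where the relative coefficient determinant does not vanish, `D ↦ ξ_D x` is injective. -/
theorem IsRelCoeffDet.eq_zero_of_vectorField_eq_zero {R : RationalRep G V} {K : Subgroup G}
    {W : Submodule ℂ V} {p : V → ℂ} (hp : R.IsRelCoeffDet ⊥ K ⊥ W p) {x : V} (hx : p x ≠ 0)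
    {D : Module.Dual ℂ G.regular} (hD : D ∈ G.lie K) (h0 : R.vectorField D x = 0) : D = 0 := by
  obtain ⟨m, v, w, a, ⟨-, -, hv⟩, ⟨hw, -, -⟩, ha, hpa⟩ := hp
  rw [LinearAlgebraicGroup.lie_bot, bot_sup_eq] at hv
  rw [← hv] at hD
  obtain ⟨c, rfl⟩ := (Submodule.mem_span_range_iff_exists_fun ℂ).1 hD
  have hc : c = 0 := by
    by_contra hc
    refine hx ?_
    rw [hpa]
    refine Matrix.exists_mulVec_eq_zero_iff.1 ⟨c, hc, funext ?_⟩
    refine Fintype.linearIndependent_iff.1 hw _ ?_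
    rw [← h0, ← vectorFieldAt_apply, map_sum]
    simp only [map_smul, vectorFieldAt_apply, mulVec, dotProduct, Finset.sum_smul]
    rw [Finset.sum_comm]
    refine Finset.sum_congr rfl fun i _ => ?_
    have := ha x i
    rw [Submodule.mem_bot, sub_eq_zero] at this
    rw [this, Finset.smul_sum]
    exact Finset.sum_congr rfl fun j _ => by rw [smul_smul, mul_comm]
  simp [hc]

/-- Tangent vectors of the ineffective part have zero vector field, while `D ↦ ξ_D x` is injective
on `Lie K` wherever `p x ≠ 0`. -/
theorem IsRelCoeffDet.lie_kernelMod_bot_inf {R : RationalRep G V} {K : Subgroup G}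
    {W : Submodule ℂ V} {p : V → ℂ} (hp : R.IsRelCoeffDet ⊥ K ⊥ W p) (hp0 : p ≠ 0) :
    G.lie (R.kernelMod ⊥ ⊓ K) = ⊥ := by
  obtain ⟨x, hx⟩ := Function.ne_iff.1 hp0
  refine eq_bot_iff.2 fun D hD => ?_
  exact hp.eq_zero_of_vectorField_eq_zero hx (LinearAlgebraicGroup.lie_mono inf_le_right hD)
    ((Submodule.mem_bot ℂ).1 (R.vectorField_mem inf_le_left hD x))

/-- The coefficient determinant is unique up to a scalar. -/
theorem IsCoeffDet.eq_const_mul {R : RationalRep G V} {q q' : V → ℂ} (hq : R.IsCoeffDet q)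
    (hq' : R.IsCoeffDet q') : ∃ c : ℂ, ∀ x, q' x = c * q x := by
  obtain ⟨m, v, w, a, ⟨hv, -, hvs⟩, ⟨hw, -, hws⟩, ha, hqa⟩ := hq
  obtain ⟨m', v', w', a', ⟨hv', -, hvs'⟩, ⟨hw', -, hws'⟩, ha', hqa'⟩ := hq'
  rw [LinearAlgebraicGroup.lie_bot, bot_sup_eq] at hvs hvs'
  rw [bot_sup_eq] at hws hws'
  have hmm : m = m' := by
    have h1 := finrank_span_eq_card hw
    have h2 := finrank_span_eq_card hw'
    rw [hws, Fintype.card_fin] at h1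
    rw [hws', Fintype.card_fin] at h2
    exact h1.symm.trans h2
  subst hmm
  have hC : ∀ i, ∃ c : Fin m → ℂ, ∑ k, c k • v k = v' i := fun i =>
    (Submodule.mem_span_range_iff_exists_fun ℂ).1 (by
      rw [hvs, ← hvs']
      exact Submodule.subset_span ⟨i, rfl⟩)
  have hB : ∀ j, ∃ b : Fin m → ℂ, ∑ k, b k • w' k = w j := fun j =>
    (Submodule.mem_span_range_iff_exists_fun ℂ).1 (by
      rw [hws']
      trivial)
  choose C hC using hC
  choose B hB using hB
  -- Change of bases: `C` expresses `v'` through `v`, and `B` expresses `w` through `w'`.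
  refine ⟨(Matrix.of B)ᵀ.det * (Matrix.of C)ᵀ.det, fun x => ?_⟩
  have hmat : a' x = (Matrix.of B)ᵀ * a x * (Matrix.of C)ᵀ := by
    ext l i
    have h1 : ∀ i, R.vectorField (v i) x = ∑ j, a x j i • w j := fun i =>
      sub_eq_zero.1 ((Submodule.mem_bot ℂ).1 (ha x i))
    have h2 : ∀ i, R.vectorField (v' i) x = ∑ j, a' x j i • w' j := fun i =>
      sub_eq_zero.1 ((Submodule.mem_bot ℂ).1 (ha' x i))
    have h3 : ∑ l, a' x l i • w' l =
        ∑ l, ((Matrix.of B)ᵀ * a x * (Matrix.of C)ᵀ) l i • w' l := by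
      rw [← h2, ← hC i, ← vectorFieldAt_apply, map_sum]
      simp only [map_smul, vectorFieldAt_apply, h1, Matrix.mul_apply, Matrix.transpose_apply,
        Matrix.of_apply, ← hB, Finset.sum_smul, Finset.smul_sum, smul_smul, Finset.sum_mul]
      rw [Finset.sum_comm' (t' := Finset.univ) (s' := fun _ => Finset.univ) (by simp)]
      rw [Finset.sum_congr rfl fun j _ => Finset.sum_comm]
      rw [Finset.sum_comm]
      refine Finset.sum_congr rfl fun l _ => ?_
      rw [Finset.sum_comm]
      exact Finset.sum_congr rfl fun k _ => Finset.sum_congr rfl fun j _ => by congr 1; ring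
    have := Fintype.linearIndependent_iff.1 hw'
      (fun l => a' x l i - ((Matrix.of B)ᵀ * a x * (Matrix.of C)ᵀ) l i)
      (by simp only [sub_smul, Finset.sum_sub_distrib, h3, sub_self]) l
    exact sub_eq_zero.1 this
  rw [hqa, hqa', hmat, det_mul, det_mul]
  ring

end VectorField

end RationalRep

/-! ### Germs of holomorphic functions -/

section Germs

variable {U V : Type*} [NormedAddCommGroup U] [NormedSpace ℂ U] [NormedAddCommGroup V]
  [NormedSpace ℂ V]

theorem ContinuousLinearMap.tendsto_nhds_zero (L : V →L[ℂ] U) : Tendsto L (𝓝 0) (𝓝 0) :=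
  L.continuous.tendsto' 0 0 (map_zero L)

/-- Pullback of holomorphic germs along a continuous linear map. -/
def holomorphicGerms.pullback (L : V →L[ℂ] U) : holomorphicGerms U →+* holomorphicGerms V where
  toFun F := ⟨F.1.compTendsto L L.tendsto_nhds_zero, by
    obtain ⟨_, f, hf, rfl⟩ := F
    exact ⟨f ∘ L, AnalyticAt.comp (by simpa using hf) (L.analyticAt 0), rfl⟩⟩
  map_one' := rfl
  map_zero' := rfl
  map_mul' := by
    rintro ⟨_, f, hf, rfl⟩ ⟨_, g, hg, rfl⟩
    rfl
  map_add' := by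
    rintro ⟨_, f, hf, rfl⟩ ⟨_, g, hg, rfl⟩
    rfl

theorem holomorphicGerms.pullback_coe (L : V →L[ℂ] U) {F : holomorphicGerms U} {f : U → ℂ}
    (h : F.1 = (f : Germ (𝓝 (0 : U)) ℂ)) :
    (pullback L F).1 = ((fun x => f (L x) : V → ℂ) : Germ (𝓝 (0 : V)) ℂ) := by
  change F.1.compTendsto L L.tendsto_nhds_zero = _
  rw [h]
  rfl

theorem holomorphicGerms.isUnit_iff {F : holomorphicGerms V} : IsUnit F ↔ F.1.value ≠ 0 := by
  constructor
  · rintro h h0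
    obtain ⟨H, hH⟩ := h.exists_right_inv
    have h1 : (F.1 * H.1).value = 1 := by
      have : F.1 * H.1 = 1 := congrArg Subtype.val hH
      rw [this]
      rfl
    have h2 : (F.1 * H.1).value = F.1.value * H.1.value := map_mul Germ.valueMulHom F.1 H.1
    rw [h2, h0, zero_mul] at h1
    exact zero_ne_one h1
  · obtain ⟨_, f, hf, rfl⟩ := F
    intro h
    have hf0 : f 0 ≠ 0 := h
    refine IsUnit.of_mul_eq_one ⟨(f⁻¹ : V → ℂ), f⁻¹, hf.inv hf0, rfl⟩ (Subtype.ext ?_)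
    refine Germ.coe_eq.2 ?_
    filter_upwards [hf.continuousAt.eventually_ne hf0] with x hx
    exact mul_inv_cancel₀ hx

/-- A germ is a unit exactly if its value at `0` is nonzero, and `L` fixes `0`. So units are
detected after pullback along any linear map, in particular along a section. -/
theorem holomorphicGerms.isUnit_pullback_iff (L : V →L[ℂ] U) {F : holomorphicGerms U} :
    IsUnit (pullback L F) ↔ IsUnit F := by
  rw [isUnit_iff, isUnit_iff]
  obtain ⟨_, f, hf, rfl⟩ := F
  have : (pullback L ⟨f, f, hf, rfl⟩).1.value = f (L 0) := rfl
  rw [this, map_zero]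
  rfl

variable [FiniteDimensional ℂ U] [FiniteDimensional ℂ V] {π : V →ₗ[ℂ] U} {s : U →ₗ[ℂ] V}

theorem holomorphicGerms.pullback_section (h : ∀ u, π (s u) = u) (F : holomorphicGerms U) :
    pullback s.toContinuousLinearMap (pullback π.toContinuousLinearMap F) = F := by
  obtain ⟨_, f, hf, rfl⟩ := F
  refine Subtype.ext ?_
  change ((f ∘ π) ∘ s : Germ (𝓝 (0 : U)) ℂ) = f
  congr 1
  exact funext fun u => congrArg f (h u)

/-- If `d * d` divides the pullback along `π`, restriction along `s` gives a square dividing the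
germ of `f`. So the restriction of `d` is a unit, and then `d` is one. The same argument serves for
relatively prime germs. -/
theorem IsReducedGerm.comp_linearMap {f : U → ℂ} (hf : IsReducedGerm f)
    (h : ∀ u, π (s u) = u) : IsReducedGerm fun x => f (π x) := by
  obtain ⟨F, hF, hsq⟩ := hf
  refine ⟨_, holomorphicGerms.pullback_coe π.toContinuousLinearMap hF, fun d hd => ?_⟩
  have h1 := map_dvd (holomorphicGerms.pullback s.toContinuousLinearMap) hd
  rw [holomorphicGerms.pullback_section h, map_mul] at h1
  exact (holomorphicGerms.isUnit_pullback_iff _).1 (hsq _ h1)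

theorem AreRelPrimeGerms.comp_linearMap {f g : U → ℂ} (hfg : AreRelPrimeGerms f g)
    (h : ∀ u, π (s u) = u) : AreRelPrimeGerms (fun x => f (π x)) fun x => g (π x) := by
  obtain ⟨F, H, hF, hH, hrel⟩ := hfg
  refine ⟨_, _, holomorphicGerms.pullback_coe π.toContinuousLinearMap hF,
    holomorphicGerms.pullback_coe π.toContinuousLinearMap hH, fun d hdF hdH => ?_⟩
  have h1 := map_dvd (holomorphicGerms.pullback s.toContinuousLinearMap) hdF
  have h2 := map_dvd (holomorphicGerms.pullback s.toContinuousLinearMap) hdH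
  rw [holomorphicGerms.pullback_section h] at h1 h2
  exact (holomorphicGerms.isUnit_pullback_iff _).1 (hrel h1 h2)

theorem IsReducedGerm.ne_zero {V : Type*} [NormedAddCommGroup V] [NormedSpace ℂ V] {f : V → ℂ} (hf : IsReducedGerm f) : f ≠ 0 := by
  rintro rfl
  obtain ⟨F, hF, hsq⟩ := hf
  have : F = 0 := Subtype.ext hF
  have h0 := hsq 0 (by rw [this, mul_zero])
  exact (holomorphicGerms.isUnit_iff.1 h0) rfl

/-- The germs of `f` and `h` at `0` are holomorphic and the first divides the second. -/
def GermDvd {V : Type*} [NormedAddCommGroup V] [NormedSpace ℂ V] (f h : V → ℂ) : Prop :=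
  ∃ F H : holomorphicGerms V, F.1 = (f : Germ (𝓝 (0 : V)) ℂ) ∧
    H.1 = (h : Germ (𝓝 (0 : V)) ℂ) ∧ F ∣ H

theorem AreRelPrimeGerms.of_germDvd {V : Type*} [NormedAddCommGroup V] [NormedSpace ℂ V]
    {p f h : V → ℂ} (hp : AreRelPrimeGerms p h) (hf : GermDvd f h) : AreRelPrimeGerms p f := by
  obtain ⟨P, H, hP, hH, hrel⟩ := hp
  obtain ⟨F, H', hF, hH', hdvd⟩ := hf
  obtain rfl : H = H' := Subtype.ext (hH.trans hH'.symm)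
  exact ⟨P, F, hP, hF, fun d h1 h2 => hrel h1 (h2.trans hdvd)⟩

theorem AreRelPrimeGerms.symm {V : Type*} [NormedAddCommGroup V] [NormedSpace ℂ V]
    {f h : V → ℂ} (hf : AreRelPrimeGerms f h) : AreRelPrimeGerms h f := by
  obtain ⟨F, H, hF, hH, hrel⟩ := hf
  exact ⟨H, F, hH, hF, hrel.symm⟩

theorem GermDvd.comp_linearMap {U : Type*} [NormedAddCommGroup U] [NormedSpace ℂ U]
    {f h : U → ℂ} (hf : GermDvd f h) (π : V →ₗ[ℂ] U) :
    GermDvd (fun x => f (π x)) fun x => h (π x) := by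
  obtain ⟨F, H, hF, hH, hdvd⟩ := hf
  exact ⟨_, _, holomorphicGerms.pullback_coe π.toContinuousLinearMap hF,
    holomorphicGerms.pullback_coe π.toContinuousLinearMap hH, map_dvd _ hdvd⟩

/-- The germ of a constant function. -/
def holomorphicGerms.const (V : Type*) [NormedAddCommGroup V] [NormedSpace ℂ V] (c : ℂ) :
    holomorphicGerms V := ⟨((fun _ => c : V → ℂ) : Germ (𝓝 (0 : V)) ℂ), _, analyticAt_const, rfl⟩

/-- Here `hf` supplies the holomorphic germs of `f` and `h`. The constant `c` may be `0`, since
divisibility holds all the same. -/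
theorem AreRelPrimeGerms.germDvd_left {V : Type*} [NormedAddCommGroup V] [NormedSpace ℂ V]
    {f h : V → ℂ} (hf : AreRelPrimeGerms f h) (c : ℂ) : GermDvd f fun x => c * (f x * h x) := by
  obtain ⟨F, H, hF, hH, -⟩ := hf
  refine ⟨F, holomorphicGerms.const V c * (F * H), hF, ?_,
    Dvd.dvd.mul_left (dvd_mul_right F H) _⟩
  change _ * (F.1 * H.1) = _
  rw [hF, hH]
  rfl

theorem GermDvd.trans_relPrime {V : Type*} [NormedAddCommGroup V] [NormedSpace ℂ V]
    {e f h : V → ℂ} (he : GermDvd e h) (hf : AreRelPrimeGerms f h) (c : ℂ) :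
    GermDvd e fun x => c * (f x * h x) := by
  obtain ⟨F, H, hF, hH, -⟩ := hf
  obtain ⟨E, H', hE, hH', hdvd⟩ := he
  obtain rfl : H = H' := Subtype.ext (hH.trans hH'.symm)
  refine ⟨E, holomorphicGerms.const V c * (F * H), hE, ?_,
    (hdvd.mul_left F).mul_left _⟩
  change _ * (F.1 * H.1) = _
  rw [hF, hH]
  rfl

end Germs

/-! ### Zariski open sets and affine maps -/

theorem IsZariskiOpen.preimage {U U' : Type*} [AddCommGroup U] [Module ℂ U] [AddCommGroup U']
    [Module ℂ U'] {S : Set U'} (hS : IsZariskiOpen S) (L : U →ₗ[ℂ] U') (c : U') :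
    IsZariskiOpen ((fun x => L x + c) ⁻¹' S) := by
  let := zariskiTopology (polyFunctions U)
  let := zariskiTopology (polyFunctions U')
  have : Continuous fun x => L x + c := by
    refine continuous_zariski fun f hf => ?_
    induction hf using Algebra.adjoin_induction with
    | mem f hf =>
      obtain ⟨φ, rfl⟩ := hf
      have : (fun x => φ (L x + c)) = ((φ ∘ₗ L : Module.Dual ℂ U) : U → ℂ) +
          algebraMap ℂ (U → ℂ) (φ c) := by
        ext x
        simp
      rw [this]
      exact add_mem (Algebra.subset_adjoin ⟨_, rfl⟩) (Subalgebra.algebraMap_mem _ _)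
    | algebraMap r => exact Subalgebra.algebraMap_mem _ r
    | add f g _ _ hf hg => exact add_mem hf hg
    | mul f g _ _ hf hg => exact mul_mem hf hg
  exact this.isOpen_preimage S hS

theorem IsZariskiOpen.iUnion {U : Type*} [AddCommGroup U] [Module ℂ U] {ι : Type*} {S : ι → Set U}
    (hS : ∀ i, IsZariskiOpen (S i)) : IsZariskiOpen (⋃ i, S i) :=
  @isOpen_iUnion _ _ (zariskiTopology (polyFunctions U)) _ hS

/-- A relatively open orbit of `K` gives one of each bigger group preserving the subspaces. -/
theorem RationalRep.HasRelativelyOpenOrbit.mono {G : LinearAlgebraicGroup} {V : Type*}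
    [AddCommGroup V] [Module ℂ V] {R : RationalRep G V} {K N : Subgroup G} {W' W : Submodule ℂ V}
    (h : R.HasRelativelyOpenOrbit K W' W) (hKN : K ≤ N) (hK : K ≤ R.kernelMod W)
    (hW' : R.IsInvariant W') (hW : R.IsInvariant W) : R.HasRelativelyOpenOrbit N W' W := by
  obtain ⟨x, hx⟩ := h
  refine ⟨x, fun P hP => ?_⟩
  have hop := hx P hP
  let M : G → (V ⧸ W') →ₗ[ℂ] (V ⧸ W') := fun g => W'.mapQ W' (R.ρ g) fun y hy => hW' g y hy
  have hM : ∀ g y, M g (W'.mkQ y) = W'.mkQ (R.ρ g y) := fun _ _ => rfl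
  have hMM : ∀ g y, M g (M g⁻¹ y) = y := by
    intro g y
    obtain ⟨y, rfl⟩ := W'.mkQ_surjective y
    rw [hM, hM, ← Module.End.mul_apply, ← map_mul, mul_inv_cancel, map_one, Module.End.one_apply]
  have hMU : ∀ g, ∀ y ∈ W.map W'.mkQ, M g y ∈ W.map W'.mkQ := by
    rintro g _ ⟨y, hy, rfl⟩
    exact ⟨R.ρ g y, hW g y hy, rfl⟩
  let MU : G → ↥(W.map W'.mkQ) →ₗ[ℂ] ↥(W.map W'.mkQ) := fun g => (M g).restrict (hMU g)
  have hMU' : ∀ g y, MU g (MU g⁻¹ y) = y := fun g y => Subtype.ext (hMM g y)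
  have hMU'' : ∀ g y, MU g⁻¹ (MU g y) = y := fun g y => by
    have := hMU' g⁻¹ y
    rwa [inv_inv] at this
  -- `P` need not be equivariant. Still, `n` acts on the projected `K`-orbit through the affine map
  -- with linear part `MU n` and translation `c n`.
  let c : G → ↥(W.map W'.mkQ) := fun n => P (M n (W'.mkQ x)) - MU n (P (W'.mkQ x))
  have key : ∀ n : G, ∀ k ∈ K, P (W'.mkQ (R.ρ (n * k) x)) =
      MU n (P (W'.mkQ (R.ρ k x))) + c n := by
    intro n k hk
    have hz : W'.mkQ (R.ρ k x - x) ∈ W.map W'.mkQ := ⟨_, hK hk x, rfl⟩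
    have h1 : P (W'.mkQ (R.ρ k x)) = P (W'.mkQ x) + ⟨_, hz⟩ := by
      rw [← hP ⟨_, hz⟩, ← map_add]
      simp
    have h2 : W'.mkQ (R.ρ (n * k) x) = M n (W'.mkQ x) + (MU n ⟨_, hz⟩ : V ⧸ W') := by
      change _ = M n (W'.mkQ x) + M n (W'.mkQ (R.ρ k x - x))
      rw [hM, hM, map_mul, Module.End.mul_apply, ← map_add, ← map_add, add_sub_cancel]
    rw [h2, map_add, hP, h1, map_add]
    simp only [c]
    abel
  -- The projected `N`-orbit is a union of affine images of the projected `K`-orbit, written as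
  -- preimages under the inverse affine maps.
  have hset : (Set.range fun g : N => P (W'.mkQ (R.ρ (g : G) x))) =
      ⋃ n : N, (fun y => MU (n : G)⁻¹ y + -(MU (n : G)⁻¹ (c n))) ⁻¹'
        (Set.range fun g : K => P (W'.mkQ (R.ρ (g : G) x))) := by
    ext y
    simp only [Set.mem_range, Set.mem_iUnion, Set.mem_preimage]
    constructor
    · rintro ⟨n, rfl⟩
      refine ⟨n, 1, ?_⟩
      have := key n 1 K.one_mem
      rw [mul_one] at this
      rw [this, map_add, hMU'']
      simp
    · rintro ⟨n, k, hk⟩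
      refine ⟨⟨n * k, N.mul_mem n.2 (hKN k.2)⟩, ?_⟩
      rw [key n k k.2, hk, map_add, map_neg, hMU', hMU']
      abel
  rw [hset]
  exact IsZariskiOpen.iUnion fun n => hop.preimage _ _

/-! ### Complementary bases -/

section ComplementaryBasis

variable {M N : Type*} [AddCommGroup M] [Module ℂ M] [AddCommGroup N] [Module ℂ N]

/-- `f` kills `A` and undoes `s`, so disjointness can be tested after applying `f`. It is used both
for Lie algebras and for the subspaces of `V`. -/
theorem IsComplementaryBasis.lift {f : M →ₗ[ℂ] N} {s : N →ₗ[ℂ] M} (hfs : ∀ y, f (s y) = y)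
    {A : Submodule ℂ M} (hA : ∀ x ∈ A, f x = 0) {B' B : Submodule ℂ N} {m : ℕ} {b : Fin m → N}
    (hb : IsComplementaryBasis B' B b) :
    IsComplementaryBasis (A ⊔ B'.map s) (A ⊔ B.map s) fun i => s (b i) := by
  obtain ⟨h₁, h₂, h₃⟩ := hb
  have hker : LinearMap.ker s = ⊥ :=
    LinearMap.ker_eq_bot.2 (Function.LeftInverse.injective (g := f) hfs)
  have hspan : Submodule.span ℂ (Set.range fun i => s (b i)) =
      (Submodule.span ℂ (Set.range b)).map s := by
    rw [Submodule.map_span, ← Set.range_comp]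
    rfl
  refine ⟨h₁.map' s hker, ?_, ?_⟩
  · rw [hspan, Submodule.disjoint_def]
    rintro _ hx ⟨y, hy, rfl⟩
    obtain ⟨a, ha, _, ⟨n, hn, rfl⟩, h⟩ := Submodule.mem_sup.1 hx
    have : n = y := by
      have := congrArg f h
      rwa [map_add, hA a ha, zero_add, hfs, hfs] at this
    rw [Submodule.disjoint_def.1 h₂ y (this ▸ hn) hy, map_zero]
  · rw [hspan, sup_assoc, ← Submodule.map_sup, h₃]

theorem IsComplementaryBasis.append {f : M →ₗ[ℂ] N} {s : N →ₗ[ℂ] M} (hfs : ∀ y, f (s y) = y)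
    {A : Submodule ℂ M} (hA : ∀ x ∈ A, f x = 0) {B : Submodule ℂ N} {m n : ℕ} {a : Fin m → M}
    {b : Fin n → N} (ha : IsComplementaryBasis ⊥ A a) (hb : IsComplementaryBasis ⊥ B b) :
    IsComplementaryBasis ⊥ (A ⊔ B.map s) (Fin.append a fun i => s (b i)) := by
  obtain ⟨ha₁, -, ha₃⟩ := ha
  obtain ⟨hb₁, hb₂, hb₃⟩ := IsComplementaryBasis.lift hfs hA hb
  rw [bot_sup_eq] at ha₃
  rw [Submodule.map_bot, sup_bot_eq] at hb₂ hb₃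
  have hrange : Set.range (Fin.append a fun i => s (b i)) =
      Set.range a ∪ Set.range fun i => s (b i) := by
    ext x
    simp only [Set.mem_range, Set.mem_union]
    constructor
    · rintro ⟨i, rfl⟩
      refine Fin.addCases (fun i => ?_) (fun i => ?_) i
      · exact Or.inl ⟨i, by simp⟩
      · exact Or.inr ⟨i, by simp⟩
    · rintro (⟨i, rfl⟩ | ⟨i, rfl⟩)
      · exact ⟨Fin.castAdd n i, by simp⟩
      · exact ⟨Fin.natAdd m i, by simp⟩
  refine ⟨?_, disjoint_bot_left, ?_⟩
  · have h := ha₁.sum_type hb₁ (by rw [ha₃]; exact hb₂)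
    have h2 : (Fin.append a fun i => s (b i)) = Sum.elim a (fun i => s (b i)) ∘ finSumFinEquiv.symm := by
      funext i
      refine Fin.addCases (fun i => ?_) (fun i => ?_) i <;> simp
    rw [h2]
    exact h.comp _ finSumFinEquiv.symm.injective
  · rw [bot_sup_eq, hrange, Submodule.span_union, ha₃, hb₃]

end ComplementaryBasis

theorem finrank_sup_map_section {M N : Type*} [AddCommGroup M] [Module ℂ M] [AddCommGroup N]
    [Module ℂ N] {f : M →ₗ[ℂ] N} {s : N →ₗ[ℂ] M} (hfs : ∀ y, f (s y) = y) {A : Submodule ℂ M}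
    (hA : ∀ x ∈ A, f x = 0) {B : Submodule ℂ N} [FiniteDimensional ℂ A] [FiniteDimensional ℂ B] :
    Module.finrank ℂ ↥(A ⊔ B.map s) = Module.finrank ℂ A + Module.finrank ℂ B := by
  have hs : Function.Injective s := Function.LeftInverse.injective (g := f) hfs
  have h := Submodule.finrank_sup_add_finrank_inf_eq A (B.map s)
  have hinf : A ⊓ B.map s = ⊥ := by
    refine eq_bot_iff.2 ?_
    rintro _ ⟨hx, y, hy, rfl⟩
    have := hA _ hx
    rw [hfs] at this
    rw [this, map_zero]
    exact Submodule.zero_mem _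
  rw [hinf, finrank_bot, add_zero] at h
  rw [h, ← (Submodule.equivMapOfInjective s hs B).finrank_eq]

/-! ### Split extensions of representations -/

/-- A morphism of representations `(G, V) → (H, U)` with a section, with kernels `K` and `W`. -/
structure SplitExtension {G H : LinearAlgebraicGroup} {V U : Type*} [AddCommGroup V] [Module ℂ V]
    [AddCommGroup U] [Module ℂ U] (R : RationalRep G V) (S : RationalRep H U) (K : Subgroup G)
    (W : Submodule ℂ V) where
  inc : H →* G
  proj : G →* H
  incV : U →ₗ[ℂ] V
  projV : V →ₗ[ℂ] U
  inc_regular : ∀ f ∈ G.regular, (fun h => f (inc h)) ∈ H.regular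
  proj_regular : ∀ f ∈ H.regular, (fun g => f (proj g)) ∈ G.regular
  proj_inc : ∀ h, proj (inc h) = h
  projV_incV : ∀ u, projV (incV u) = u
  ker_proj : proj.ker = K
  ker_projV : LinearMap.ker projV = W
  projV_ρ : ∀ g x, projV (R.ρ g x) = S.ρ (proj g) (projV x)

namespace SplitExtension

variable {G H : LinearAlgebraicGroup} {V U : Type*} [AddCommGroup V] [Module ℂ V]
  [AddCommGroup U] [Module ℂ U] {R : RationalRep G V} {S : RationalRep H U} {K : Subgroup G}
  {W : Submodule ℂ V} (X : SplitExtension R S K W)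

include X

theorem mem_K {g : G} : g ∈ K ↔ X.proj g = 1 :=
  (SetLike.ext_iff.1 X.ker_proj g).symm.trans MonoidHom.mem_ker

theorem mem_W {x : V} : x ∈ W ↔ X.projV x = 0 :=
  (SetLike.ext_iff.1 X.ker_projV x).symm.trans LinearMap.mem_ker

theorem proj_surjective : Function.Surjective X.proj := fun h => ⟨_, X.proj_inc h⟩

theorem projV_surjective : Function.Surjective X.projV := fun u => ⟨_, X.projV_incV u⟩

theorem isInvariant_comap {W' : Submodule ℂ U} (h : S.IsInvariant W') :
    R.IsInvariant (W'.comap X.projV) := fun g x hx => by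
  rw [Submodule.mem_comap, X.projV_ρ]
  exact h _ _ hx

theorem kernelMod_comap (W' : Submodule ℂ U) :
    R.kernelMod (W'.comap X.projV) = (S.kernelMod W').comap X.proj := by
  ext g
  simp only [RationalRep.mem_kernelMod, Subgroup.mem_comap, Submodule.mem_comap, map_sub, X.projV_ρ]
  exact ⟨fun h u => by simpa [X.projV_incV] using h (X.incV u), fun h x => h _⟩

theorem comap_bot : (⊥ : Submodule ℂ U).comap X.projV = W := X.ker_projV

theorem comap_eq_sup (W' : Submodule ℂ U) : W'.comap X.projV = W ⊔ W'.map X.incV := by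
  apply le_antisymm
  · intro x hx
    rw [← sub_add_cancel x (X.incV (X.projV x))]
    refine Submodule.add_mem_sup ?_ ⟨_, hx, rfl⟩
    rw [X.mem_W, map_sub, X.projV_incV, sub_self]
  · refine sup_le (fun x hx => ?_) ?_
    · rw [Submodule.mem_comap, X.mem_W.1 hx]
      exact W'.zero_mem
    · rintro _ ⟨u, hu, rfl⟩
      rw [Submodule.mem_comap, X.projV_incV]
      exact hu

theorem isClosed_comap {L : Subgroup H} (hL : IsClosed[H.zariski] (L : Set H)) :
    IsClosed[G.zariski] (L.comap X.proj : Set G) := by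
  let := G.zariski
  let := H.zariski
  exact IsClosed.preimage (continuous_zariski X.proj_regular) hL

theorem relIndex_comap {L N : Subgroup H} (h : L.relIndex N ≠ 0) :
    (L.comap X.proj).relIndex (N.comap X.proj) ≠ 0 := by
  rwa [Subgroup.relIndex_comap, Subgroup.map_comap_eq_self_of_surjective X.proj_surjective]

/-- The projection identifies `V / π⁻¹ W'` with `U / W'` and, being surjective on groups, the orbit
of `incV u` with that of `u`. A linear projection `Q` upstairs is transported to `Q'` downstairs,
where openness is known. -/
theorem hasRelativelyOpenOrbit_comap {L : Subgroup H} {W' W'' : Submodule ℂ U}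
    (h : S.HasRelativelyOpenOrbit L W' W'') :
    R.HasRelativelyOpenOrbit (L.comap X.proj) (W'.comap X.projV) (W''.comap X.projV) := by
  obtain ⟨u, hu⟩ := h
  refine ⟨X.incV u, ?_⟩
  set Z' := W'.comap X.projV
  set Z'' := W''.comap X.projV
  intro Q hQ
  let α : (V ⧸ Z') →ₗ[ℂ] U ⧸ W' := Z'.mapQ W' X.projV le_rfl
  let β : (U ⧸ W') →ₗ[ℂ] V ⧸ Z' := W'.mapQ Z' X.incV fun y hy => by
    change X.projV (X.incV y) ∈ W'
    rwa [X.projV_incV]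
  have hα : ∀ x, α (Z'.mkQ x) = W'.mkQ (X.projV x) := fun _ => rfl
  have hβ : ∀ y, β (W'.mkQ y) = Z'.mkQ (X.incV y) := fun _ => rfl
  have hαβ : ∀ y, α (β y) = y := fun y => by
    obtain ⟨y, rfl⟩ := W'.mkQ_surjective y
    rw [hβ, hα, X.projV_incV]
  have hβα : ∀ y, β (α y) = y := fun y => by
    obtain ⟨y, rfl⟩ := Z'.mkQ_surjective y
    rw [hα, hβ, ← sub_eq_zero, ← map_sub]
    refine (Submodule.Quotient.mk_eq_zero Z').2 ?_
    change X.projV _ ∈ W'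
    rw [map_sub, X.projV_incV, sub_self]
    exact W'.zero_mem
  have hαm : ∀ y ∈ Z''.map Z'.mkQ, α y ∈ W''.map W'.mkQ := by
    rintro _ ⟨y, hy, rfl⟩
    exact ⟨_, hy, rfl⟩
  have hβm : ∀ y ∈ W''.map W'.mkQ, β y ∈ Z''.map Z'.mkQ := by
    rintro _ ⟨y, hy, rfl⟩
    refine ⟨X.incV y, ?_, rfl⟩
    change X.projV (X.incV y) ∈ W''
    rwa [X.projV_incV]
  let γ : ↥(Z''.map Z'.mkQ) →ₗ[ℂ] ↥(W''.map W'.mkQ) := α.restrict hαm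
  have hγ : Function.Injective γ := fun y z h => Subtype.ext (by
    rw [← hβα y, ← hβα z]
    exact congrArg (fun t : ↥(W''.map W'.mkQ) => β t) h)
  let Q' : (U ⧸ W') →ₗ[ℂ] ↥(W''.map W'.mkQ) := γ ∘ₗ Q ∘ₗ β
  have hQ' : ∀ w : ↥(W''.map W'.mkQ), Q' w = w := fun w => Subtype.ext (by
    change α (Q (β w)) = w
    have := hQ ⟨β w, hβm _ w.2⟩
    rw [this]
    exact hαβ w)
  have hop := hu Q' hQ'
  have hproj : ∀ g : G, Q' (W'.mkQ (S.ρ (X.proj g) u)) = γ (Q (Z'.mkQ (R.ρ g (X.incV u)))) := by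
    intro g
    change γ (Q (β _)) = _
    rw [← hβα (Z'.mkQ (R.ρ g (X.incV u))), hα, X.projV_ρ, X.projV_incV]
  have hset : (Set.range fun g : L.comap X.proj => Q (Z'.mkQ (R.ρ (g : G) (X.incV u)))) =
      (fun y => γ y + 0) ⁻¹' Set.range fun g : L => Q' (W'.mkQ (S.ρ (g : H) u)) := by
    ext y
    simp only [Set.mem_range, Set.mem_preimage, add_zero]
    constructor
    · rintro ⟨g, rfl⟩
      exact ⟨⟨X.proj g, g.2⟩, hproj g⟩
    · rintro ⟨h, hh⟩
      refine ⟨⟨X.inc h, ?_⟩, hγ ?_⟩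
      · rw [Subgroup.mem_comap, X.proj_inc]
        exact h.2
      · rw [← hh, ← hproj, X.proj_inc]
  rw [hset]
  exact hop.preimage γ 0

/-- The differential of the projection `G → H`. -/
def dproj : Module.Dual ℂ G.regular →ₗ[ℂ] Module.Dual ℂ H.regular :=
  (LinearAlgebraicGroup.pullback X.proj X.proj_regular).toLinearMap.dualMap

/-- The differential of the section `H → G`. -/
def dinc : Module.Dual ℂ H.regular →ₗ[ℂ] Module.Dual ℂ G.regular :=
  (LinearAlgebraicGroup.pullback X.inc X.inc_regular).toLinearMap.dualMap

theorem dproj_dinc (E : Module.Dual ℂ H.regular) : X.dproj (X.dinc E) = E := by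
  ext f
  change E (LinearAlgebraicGroup.pullback X.inc X.inc_regular
    (LinearAlgebraicGroup.pullback X.proj X.proj_regular f)) = E f
  congr 1
  exact Subtype.ext (funext fun h => congrArg f.1 (X.proj_inc h))

theorem dproj_eq_zero {D : Module.Dual ℂ G.regular} (hD : D ∈ G.lie K) : X.dproj D = 0 := by
  have : X.dproj D ∈ H.lie ⊥ := LinearAlgebraicGroup.comp_pullback_mem_lie X.proj_regular
    (map_one _) (fun g hg => X.mem_K.1 hg) hD
  rwa [LinearAlgebraicGroup.lie_bot, Submodule.mem_bot] at this

/-- Every `g` is `κ g * inc (proj g)` with `κ g ∈ K`. Differentiating this product at `1` splits a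
tangent vector into one of `K` and the lift of its projection. -/
theorem lie_comap (L : Subgroup H) :
    G.lie (L.comap X.proj) = G.lie K ⊔ (H.lie L).map X.dinc := by
  apply le_antisymm
  · intro D hD
    let κ : G → G := fun g => g * X.inc (X.proj g⁻¹)
    have hip : ∀ f ∈ G.regular, (fun g => f (X.inc (X.proj g))) ∈ G.regular := fun f hf =>
      X.proj_regular _ (X.inc_regular f hf)
    have hκ : ∀ f ∈ G.regular, (fun g => f (κ g)) ∈ G.regular := fun f hf =>
      LinearAlgebraicGroup.comp_mul_mem (α := fun g => g) (β := fun g => X.inc (X.proj g⁻¹))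
        (fun _ h => h) (fun f hf => LinearAlgebraicGroup.comp_inv_mem (hip f hf)) hf
    have hD' : D ∈ G.lie ⊤ := LinearAlgebraicGroup.lie_mono le_top hD
    have hκ1 : κ 1 = 1 := by simp [κ]
    have hsum := LinearAlgebraicGroup.comp_pullback_mul (α := κ) (β := fun g => X.inc (X.proj g))
      hκ hip hκ1 (by simp) hD'
    have hid : D ∘ₗ (LinearAlgebraicGroup.pullback (fun g => κ g * X.inc (X.proj g))
        fun _ => LinearAlgebraicGroup.comp_mul_mem hκ hip).toLinearMap = D := by
      ext f
      refine congrArg D (Subtype.ext (funext fun g => ?_))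
      simp [κ]
    rw [hid] at hsum
    rw [hsum]
    refine Submodule.add_mem_sup ?_ ⟨X.dproj D, ?_, rfl⟩
    · refine LinearAlgebraicGroup.comp_pullback_mem_lie hκ hκ1 (fun g _ => ?_) hD
      rw [X.mem_K]
      simp [κ, X.proj_inc]
    · exact LinearAlgebraicGroup.comp_pullback_mem_lie X.proj_regular (map_one _)
        (fun g hg => hg) hD
  · refine sup_le (LinearAlgebraicGroup.lie_mono fun g hg => ?_) ?_
    · rw [Subgroup.mem_comap, X.mem_K.1 hg]
      exact L.one_mem
    · rintro _ ⟨E, hE, rfl⟩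
      refine LinearAlgebraicGroup.comp_pullback_mem_lie X.inc_regular (map_one _)
        (fun h hh => ?_) hE
      rw [Subgroup.mem_comap, X.proj_inc]
      exact hh

section FiniteDimensional

variable [FiniteDimensional ℂ V] [FiniteDimensional ℂ U]

theorem dim_comap (hK : G.dim K = Module.finrank ℂ W) {L : Subgroup H} {W' : Submodule ℂ U}
    (hL : H.dim L = Module.finrank ℂ W') :
    G.dim (L.comap X.proj) = Module.finrank ℂ (W'.comap X.projV) := by
  unfold LinearAlgebraicGroup.dim at *
  rw [X.lie_comap, X.comap_eq_sup, finrank_sup_map_section X.dproj_dinc fun D => X.dproj_eq_zero,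
    finrank_sup_map_section X.projV_incV fun x => X.mem_W.1, hK, hL]

theorem projV_vectorField (D : Module.Dual ℂ G.regular) (x : V) :
    X.projV (R.vectorField D x) = S.vectorField (X.dproj D) (X.projV x) := by
  refine RationalRep.eq_of_forall_dual fun φ => ?_
  rw [← LinearMap.comp_apply, RationalRep.apply_vectorField, RationalRep.apply_vectorField]
  refine congrArg D (Subtype.ext (funext fun g => ?_))
  exact congrArg φ (X.projV_ρ g x)

/-- The lifted bases are complementary again, and modulo the preimage of `W'` their coefficient
matrix at `x` is the old one at `projV x`. -/
theorem isRelCoeffDet_comap {L' L : Subgroup H} {W' W'' : Submodule ℂ U} {p : U → ℂ}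
    (hp : S.IsRelCoeffDet L' L W' W'' p) :
    R.IsRelCoeffDet (L'.comap X.proj) (L.comap X.proj) (W'.comap X.projV) (W''.comap X.projV)
      fun x => p (X.projV x) := by
  obtain ⟨m, v, w, a, hv, hw, ha, hpa⟩ := hp
  refine ⟨m, fun i => X.dinc (v i), fun i => X.incV (w i), fun x => a (X.projV x), ?_, ?_,
    fun x i => ?_, fun x => hpa _⟩
  · rw [X.lie_comap, X.lie_comap]
    exact hv.lift X.dproj_dinc fun D => X.dproj_eq_zero
  · rw [X.comap_eq_sup, X.comap_eq_sup]
    exact hw.lift X.projV_incV fun x => X.mem_W.1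
  · rw [Submodule.mem_comap, map_sub, X.projV_vectorField, X.dproj_dinc, map_sum]
    simp only [map_smul, X.projV_incV]
    exact ha _ i

/-- Append lifted bases to those of `Lie K` and `W`. Fields from `Lie K` stay in `W`, while the
lifted fields project to those on `U`; the matrix is block triangular with diagonal blocks `a x` and
`a' (projV x)`. -/
theorem isCoeffDet_mul {p : V → ℂ} (hp : R.IsRelCoeffDet ⊥ K ⊥ W p)
    {q : U → ℂ} (hq : S.IsCoeffDet q) : R.IsCoeffDet fun x => p x * q (X.projV x) := by
  obtain ⟨m, v, w, a, hv, hw, ha, hpa⟩ := hp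
  obtain ⟨n, v', w', a', hv', hw', ha', hqa'⟩ := hq
  rw [LinearAlgebraicGroup.lie_bot] at hv hv'
  have hspan : Submodule.span ℂ (Set.range w) = W := by
    have := hw.2.2
    rwa [bot_sup_eq] at this
  -- The off-diagonal block: the `W`-component of a lifted vector field.
  have hB : ∀ x i, ∃ c : Fin m → ℂ, ∑ j, c j • w j =
      R.vectorField (X.dinc (v' i)) x - ∑ j, a' (X.projV x) j i • X.incV (w' j) := by
    intro x i
    refine (Submodule.mem_span_range_iff_exists_fun ℂ).1 ?_
    rw [hspan, X.mem_W, map_sub, X.projV_vectorField, X.dproj_dinc, map_sum]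
    simp only [map_smul, X.projV_incV]
    exact (Submodule.mem_bot ℂ).1 (ha' (X.projV x) i)
  choose B hB using hB
  refine ⟨m + n, Fin.append v fun i => X.dinc (v' i), Fin.append w fun i => X.incV (w' i),
    fun x => Matrix.reindex finSumFinEquiv finSumFinEquiv
      (Matrix.fromBlocks (a x) (Matrix.of fun j i => B x i j) 0 (a' (X.projV x))), ?_, ?_,
    fun x i => ?_, fun x => ?_⟩
  · have : (⊤ : Subgroup G) = (⊤ : Subgroup H).comap X.proj := rfl
    rw [LinearAlgebraicGroup.lie_bot, this, X.lie_comap]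
    exact hv.append X.dproj_dinc (fun D => X.dproj_eq_zero) hv'
  · have : (⊤ : Submodule ℂ V) = (⊤ : Submodule ℂ U).comap X.projV := rfl
    rw [this, X.comap_eq_sup]
    exact hw.append X.projV_incV (fun x => X.mem_W.1) hw'
  · rw [Submodule.mem_bot, sub_eq_zero, Fin.sum_univ_add]
    refine Fin.addCases (fun i => ?_) (fun i => ?_) i
    · have := ha x i
      rw [Submodule.mem_bot, sub_eq_zero] at this
      simpa using this
    · have := hB x i
      rw [eq_sub_iff_add_eq] at this
      simpa using this.symm
  · rw [Matrix.det_reindex_self, Matrix.det_fromBlocks_zero₂₁, ← hpa, ← hqa']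

end FiniteDimensional

end SplitExtension

/-! ### Block decompositions -/

namespace RationalRep

/-- Only the Lie algebras of the groups enter, so a group may be replaced by a closed subgroup of
finite index. -/
theorem IsRelCoeffDet.congr_lie {G : LinearAlgebraicGroup} {V : Type*} [AddCommGroup V]
    [Module ℂ V] [FiniteDimensional ℂ V] {R : RationalRep G V} {K' K L' L : Subgroup G}
    {W' W : Submodule ℂ V} {p : V → ℂ} (h : R.IsRelCoeffDet K' K W' W p)
    (h' : G.lie K' = G.lie L') (h'' : G.lie K = G.lie L) : R.IsRelCoeffDet L' L W' W p := by
  obtain ⟨m, v, w, a, hv, hw, ha, hpa⟩ := h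
  rw [h', h''] at hv
  exact ⟨m, v, w, a, hv, hw, ha, hpa⟩

variable {G : LinearAlgebraicGroup} {V : Type*} [NormedAddCommGroup V] [NormedSpace ℂ V]
  [FiniteDimensional ℂ V]

theorem IsNonreducedBlockDecomposition.lie_eq {R : RationalRep G V} {k : ℕ}
    {W : ℕ → Submodule ℂ V} {K : ℕ → Subgroup G} {p : ℕ → V → ℂ}
    (h : R.IsNonreducedBlockDecomposition k W K p) {j : ℕ} (hj : j ≤ k) :
    G.lie (K j) = G.lie (R.kernelMod (W j)) :=
  LinearAlgebraicGroup.lie_eq_of_relIndex_ne_zero (h.K_le j hj) (h.K_closed j hj)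
    (h.K_finiteIndex j hj)

/-- The groups in a block decomposition can be replaced by the full kernels. -/
theorem IsNonreducedBlockDecomposition.kernelMod {R : RationalRep G V} {k : ℕ}
    {W : ℕ → Submodule ℂ V} {K : ℕ → Subgroup G} {p : ℕ → V → ℂ}
    (h : R.IsNonreducedBlockDecomposition k W K p) :
    R.IsNonreducedBlockDecomposition k W (fun j => R.kernelMod (W j)) p where
  connected := h.connected
  equidimensional := h.equidimensional
  W_zero := h.W_zero
  W_top := h.W_top
  W_mono := h.W_mono
  W_invariant := h.W_invariant
  K_top := by rw [h.W_top, kernelMod_top]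
  K_mono j hj := R.kernelMod_mono (h.W_mono j hj)
  K_closed j _ := R.isClosed_kernelMod _
  K_normal j hj := R.kernelMod_normal (h.W_invariant j hj)
  K_le j _ := le_rfl
  K_finiteIndex j _ := by rw [Subgroup.relIndex_self]; exact one_ne_zero
  dim_K j hj := by
    rw [← h.dim_K j hj, LinearAlgebraicGroup.dim, LinearAlgebraicGroup.dim, h.lie_eq hj]
  openOrbit j hj := (h.openOrbit j hj).mono (h.K_le _ hj) (h.K_le _ hj)
    (h.W_invariant j hj.le) (h.W_invariant _ hj)
  relCoeffDet j hj := (h.relCoeffDet j hj).congr_lie (h.lie_eq hj.le) (h.lie_eq hj)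
  relCoeffDet_ne := h.relCoeffDet_ne

theorem IsBlockDecomposition.kernelMod {R : RationalRep G V} {k : ℕ}
    {W : ℕ → Submodule ℂ V} {K : ℕ → Subgroup G} {p : ℕ → V → ℂ}
    (h : R.IsBlockDecomposition k W K p) :
    R.IsBlockDecomposition k W (fun j => R.kernelMod (W j)) p :=
  { h.toIsNonreducedBlockDecomposition.kernelMod with
    reduced := h.reduced
    relPrime := h.relPrime }

end RationalRep

/-! ### Extending a block decomposition by one block at the bottom -/

namespace SplitExtension

variable {G H : LinearAlgebraicGroup} {V U : Type*} [NormedAddCommGroup V] [NormedSpace ℂ V]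
  [FiniteDimensional ℂ V] [NormedAddCommGroup U] [NormedSpace ℂ U] [FiniteDimensional ℂ U]
  {R : RationalRep G V} {S : RationalRep H U} {K : Subgroup G} {W : Submodule ℂ V}
  (X : SplitExtension R S K W)

/-- The relative coefficient determinants of an extended block decomposition. -/
def extendDet (p₀ : V → ℂ) (p : ℕ → U → ℂ) : ℕ → V → ℂ
  | 0 => p₀
  | j + 1 => fun x => p j (X.projV x)

include X

theorem isNonreducedBlockDecomposition
    (hcomp : G.IsIdentityComponent K (R.kernelMod W)) (hequi : R.IsEquidimensional)
    (hdim : G.dim K = Module.finrank ℂ W)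
    (hopen : R.HasRelativelyOpenOrbit K ⊥ W) (hnormal : K.Normal)
    {p₀ : V → ℂ} (hp₀ : R.IsRelCoeffDet ⊥ K ⊥ W p₀) (hp₀' : p₀ ≠ 0)
    {k : ℕ} {W' : ℕ → Submodule ℂ U} {K' : ℕ → Subgroup H} {p : ℕ → U → ℂ}
    (h : S.IsNonreducedBlockDecomposition k W' K' p) (hk : k = 0 → K = ⊤)
    {Z : ℕ → Submodule ℂ V} {N : ℕ → Subgroup G}
    (hZ₀ : Z 0 = ⊥) (hZ₁ : Z 1 = W) (hZ : ∀ j, Z (j + 2) = (W' (j + 1)).comap X.projV)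
    (hN₀ : N 0 = R.kernelMod ⊥ ⊓ K) (hN₁ : N 1 = K)
    (hN : ∀ j, N (j + 2) = (K' (j + 1)).comap X.proj) :
    R.IsNonreducedBlockDecomposition (k + 1) Z N (X.extendDet p₀ p) := by
  -- The subspaces follow one formula because `W' 0 = ⊥`. The subgroups do so only on Lie algebras
  -- (`hlie`): `N 1 = K` may be smaller than the preimage of `K' 0`, whose Lie algebra is zero.
  have hZ' : ∀ j, Z (j + 1) = (W' j).comap X.projV := by
    rintro (_ | j)
    · rw [hZ₁, h.W_zero, X.comap_bot]
    · exact hZ j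
  have hlie₀ : G.lie (N 0) = ⊥ := hN₀ ▸ hp₀.lie_kernelMod_bot_inf hp₀'
  have hlieK₀ : H.lie (K' 0) = ⊥ := by
    have := h.dim_K 0 (Nat.zero_le k)
    rw [h.W_zero, finrank_bot] at this
    exact Submodule.finrank_eq_zero.1 this
  have hlie : ∀ j, G.lie (N (j + 1)) = G.lie ((K' j).comap X.proj) := by
    rintro (_ | j)
    · rw [hN₁, X.lie_comap, hlieK₀, Submodule.map_bot, sup_bot_eq]
    · rw [hN]
  have hclosed : IsClosed[G.zariski] (K : Set G) := hcomp.isClosed (R.isClosed_kernelMod W)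
  have hfin : K.relIndex (R.kernelMod W) ≠ 0 := hcomp.relIndex_ne_zero (R.isClosed_kernelMod W)
  have hKle : K ≤ R.kernelMod W := hcomp.le
  have hKcomap : ∀ L : Subgroup H, K ≤ L.comap X.proj := fun L g hg => by
    rw [Subgroup.mem_comap, X.mem_K.1 hg]
    exact L.one_mem
  refine
    { connected := LinearAlgebraicGroup.isConnected_of_section hcomp.isPreconnected h.connected
        X.inc X.inc_regular fun g => ⟨X.proj g, by
          rw [X.mem_K, map_mul, map_inv, X.proj_inc, inv_mul_cancel]⟩
      equidimensional := hequi
      W_zero := hZ₀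
      W_top := by rw [hZ', h.W_top]; rfl
      W_mono := ?_
      W_invariant := ?_
      K_top := ?_
      K_mono := ?_
      K_closed := ?_
      K_normal := ?_
      K_le := ?_
      K_finiteIndex := ?_
      dim_K := ?_
      openOrbit := ?_
      relCoeffDet := ?_
      relCoeffDet_ne := ?_ }
  · rintro (_ | j) hj
    · rw [hZ₀]
      exact bot_le
    · rw [hZ', hZ']
      exact Submodule.comap_mono (h.W_mono j (by omega))
  · rintro (_ | j) hj
    · rw [hZ₀]
      intro g x hx
      rw [(Submodule.mem_bot ℂ).1 hx, map_zero]
      exact Submodule.zero_mem _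
    · rw [hZ']
      exact X.isInvariant_comap (h.W_invariant j (by omega))
  · cases k with
    | zero => rw [hN₁, hk rfl]
    | succ k =>
      rw [hN, h.K_top]
      rfl
  · rintro (_ | _ | j) hj
    · rw [hN₀, hN₁]
      exact inf_le_right
    · rw [hN₁, hN]
      exact hKcomap _
    · rw [hN, hN]
      exact Subgroup.comap_mono (h.K_mono _ (by omega))
  · rintro (_ | _ | j) hj
    · rw [hN₀]
      exact @IsClosed.inter _ _ _ G.zariski (R.isClosed_kernelMod ⊥) hclosed
    · rw [hN₁]
      exact hclosed
    · rw [hN]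
      exact X.isClosed_comap (h.K_closed _ (by omega))
  · rintro (_ | _ | j) hj
    · rw [hN₀]
      have := R.kernelMod_normal (W := ⊥) fun g x hx => by
        rw [(Submodule.mem_bot ℂ).1 hx, map_zero]
        exact Submodule.zero_mem _
      exact Subgroup.normal_inf_normal _ _
    · rwa [hN₁]
    · rw [hN]
      exact (h.K_normal _ (by omega)).comap _
  · rintro (_ | _ | j) hj
    · rw [hN₀, hZ₀]
      exact inf_le_left
    · rw [hN₁, hZ₁]
      exact hKle
    · rw [hN, hZ, X.kernelMod_comap]
      exact Subgroup.comap_mono (h.K_le _ (by omega))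
  · rintro (_ | _ | j) hj
    · rw [hN₀, hZ₀, Subgroup.inf_relIndex_left]
      -- `K` has finite index in the kernel on `V / W`, hence meets the smaller kernel on `V` in
      -- finite index.
      exact fun h0 => hfin (Subgroup.relIndex_eq_zero_of_le_right (R.kernelMod_mono bot_le) h0)
    · rwa [hN₁, hZ₁]
    · rw [hN, hZ, X.kernelMod_comap]
      exact X.relIndex_comap (h.K_finiteIndex _ (by omega))
  · rintro (_ | _ | j) hj
    · rw [LinearAlgebraicGroup.dim, hlie₀, hZ₀, finrank_bot, finrank_bot]
    · rwa [hN₁, hZ₁]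
    · rw [hN, hZ]
      exact X.dim_comap hdim (h.dim_K _ (by omega))
  · rintro (_ | j) hj
    · rwa [hN₁, hZ₀, hZ₁]
    · rw [hN, hZ', hZ']
      exact X.hasRelativelyOpenOrbit_comap (h.openOrbit j (by omega))
  · rintro (_ | j) hj
    · rw [hZ₀, hZ₁]
      exact hp₀.congr_lie (by rw [hlie₀, LinearAlgebraicGroup.lie_bot]) (by rw [hN₁])
    · rw [hZ', hZ']
      exact (X.isRelCoeffDet_comap (h.relCoeffDet j (by omega))).congr_lie (hlie j).symm
        (hlie (j + 1)).symm
  · rintro (_ | j) hj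
    · exact hp₀'
    · intro h0
      refine h.relCoeffDet_ne j (by omega) (funext fun u => ?_)
      obtain ⟨x, rfl⟩ := X.projV_surjective u
      exact congrFun h0 x

end SplitExtension

/-! ### Towers -/

namespace RepTower

variable {V : ℕ → Type*} [∀ l, NormedAddCommGroup (V l)] [∀ l, NormedSpace ℂ (V l)]
  [∀ l, FiniteDimensional ℂ (V l)]

theorem mk_incG_projG (T : RepTower V) {l : ℕ} {K : Subgroup (T.G (l + 1))}
    {W : Submodule ℂ (V (l + 1))} (h : T.IsQuotientIso l K W) (g : T.G (l + 1)) :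
    (T.incG l (T.projG h g) : T.G (l + 1) ⧸ K) = g := by
  have := h.normal
  exact (MulEquiv.ofBijective ((QuotientGroup.mk' K).comp (T.incG l)) h.bijectiveG).apply_symm_apply
    (QuotientGroup.mk' K g)

theorem mkQ_incV_projV (T : RepTower V) {l : ℕ} {K : Subgroup (T.G (l + 1))}
    {W : Submodule ℂ (V (l + 1))} (h : T.IsQuotientIso l K W) (x : V (l + 1)) :
    W.mkQ (T.incV l (T.projV h x)) = W.mkQ x :=
  (LinearEquiv.ofBijective (W.mkQ ∘ₗ T.incV l) h.bijectiveV).apply_symm_apply (W.mkQ x)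

/-- One step of a tower as a split extension. -/
def splitExtension (T : RepTower V) {l : ℕ} {K : Subgroup (T.G (l + 1))}
    {W : Submodule ℂ (V (l + 1))} (h : T.IsQuotientIso l K W)
    (hK : K ≤ (T.rep (l + 1)).kernelMod W) (hW : (T.rep (l + 1)).IsInvariant W) :
    SplitExtension (T.rep (l + 1)) (T.rep l) K W where
  inc := T.incG l
  proj := T.projG h
  incV := T.incV l
  projV := T.projV h
  inc_regular := T.incG_regular l
  proj_regular f hf := by
    obtain ⟨F, hF, hFK, hFf⟩ := h.regular f hf
    have : (fun g => f (T.projG h g)) = F := funext fun g => by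
      -- `g` and the lift of its projection lie in one coset of `K`, on which `F` is constant.
      have hg := QuotientGroup.eq.1 (T.mk_incG_projG h g)
      rw [← hFf, ← hFK _ _ hg, mul_inv_cancel_left]
    rwa [this]
  proj_inc g := h.bijectiveG.1 (T.mk_incG_projG h _)
  projV_incV u := h.bijectiveV.1 (T.mkQ_incV_projV h _)
  ker_proj := by
    ext g
    rw [MonoidHom.mem_ker]
    constructor
    · intro hg
      have := T.mk_incG_projG h g
      rw [hg, map_one] at this
      simpa using QuotientGroup.eq.1 this
    · intro hg
      refine h.bijectiveG.1 ((T.mk_incG_projG h g).trans ?_)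
      change _ = (T.incG l 1 : T.G (l + 1) ⧸ K)
      rw [map_one]
      exact (QuotientGroup.eq.2 (by simpa using hg)).symm
  ker_projV := by
    ext x
    rw [LinearMap.mem_ker]
    constructor
    · intro hx
      have := T.mkQ_incV_projV h x
      rw [hx, map_zero, map_zero] at this
      exact (Submodule.Quotient.mk_eq_zero W).1 this.symm
    · intro hx
      refine h.bijectiveV.1 ((T.mkQ_incV_projV h x).trans ?_)
      rw [map_zero]
      exact (Submodule.Quotient.mk_eq_zero W).2 hx
  projV_ρ g x := by
    refine h.bijectiveV.1 ((T.mkQ_incV_projV h _).trans ?_)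
    rw [LinearMap.comp_apply, T.equivariant]
    -- The lift of `projG g` is `g * k` with `k ∈ K`, and `k` acts trivially modulo `W`.
    have hk := QuotientGroup.eq.1 (T.mk_incG_projG h g).symm
    have hx : T.incV l (T.projV h x) - x ∈ W :=
      (Submodule.Quotient.eq W).1 (T.mkQ_incV_projV h x)
    have h1 : (T.rep (l + 1)).ρ (T.incG l (T.projG h g)) (T.incV l (T.projV h x)) =
        (T.rep (l + 1)).ρ g ((T.rep (l + 1)).ρ (g⁻¹ * T.incG l (T.projG h g))
          (T.incV l (T.projV h x))) := by
      rw [← Module.End.mul_apply, ← map_mul, mul_inv_cancel_left]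
    refine ((Submodule.Quotient.eq W).2 ?_).symm
    rw [h1, ← map_sub]
    refine hW g _ ?_
    have h2 := W.add_mem (hK hk (T.incV l (T.projV h x))) hx
    rwa [sub_add_sub_cancel] at h2

/-- At level `0` there is nothing to decompose. -/
theorem isNonreducedBlockDecomposition_zero (T : RepTower V) (K : Subgroup (T.G 0)) :
    (T.rep 0).IsNonreducedBlockDecomposition 0 (fun _ => ⊥) (fun _ => K) (fun _ _ => 0) := by
  have := T.G_zero
  have := T.V_zero
  have hK : K = ⊥ := Subsingleton.elim _ _
  have htop : (⊤ : Subgroup (T.G 0)) = ⊥ := Subsingleton.elim _ _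
  have hker : (T.rep 0).kernelMod ⊥ = ⊥ := Subsingleton.elim _ _
  have hdim : (T.G 0).dim ⊥ = 0 := by
    rw [LinearAlgebraicGroup.dim, LinearAlgebraicGroup.lie_bot, finrank_bot]
  let := (T.G 0).zariski
  subst hK
  refine
    { connected := ?_
      equidimensional := ?_
      W_zero := rfl
      W_top := Subsingleton.elim _ _
      W_mono := fun _ _ => le_rfl
      W_invariant := fun _ _ _ _ _ => (Submodule.mem_bot ℂ).2 (Subsingleton.elim _ _)
      K_top := htop.symm
      K_mono := fun _ _ => le_rfl
      K_closed := fun _ _ => ?_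
      K_normal := fun _ _ => inferInstance
      K_le := fun _ _ => bot_le
      K_finiteIndex := fun _ _ => ?_
      dim_K := fun _ _ => ?_
      openOrbit := fun _ h => absurd h (Nat.not_lt_zero _)
      relCoeffDet := fun _ h => absurd h (Nat.not_lt_zero _)
      relCoeffDet_ne := fun _ h => absurd h (Nat.not_lt_zero _) }
  · exact { isPreconnected_univ := Set.subsingleton_of_subsingleton.isPreconnected
            toNonempty := ⟨1⟩ }
  · rw [RationalRep.IsEquidimensional, htop, hdim, Module.finrank_zero_of_subsingleton]
  · exact isClosed_discrete _
  · rw [hker, Subgroup.relIndex_self]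
    exact one_ne_zero
  · rw [hdim, finrank_bot]

end RepTower

/-! ### The iterated decomposition and its determinants -/

namespace RepTower

variable {V : ℕ → Type*} [∀ l, NormedAddCommGroup (V l)] [∀ l, NormedSpace ℂ (V l)]
  [∀ l, FiniteDimensional ℂ (V l)]

/-- The relative coefficient determinants at level `l`: those of level `l - 1` are pulled back
along the projection, and one is added at the bottom. -/
def decompDet (T : RepTower V) (K : ∀ l, Subgroup (T.G l)) (W : ∀ l, Submodule ℂ (V l))
    (h : ∀ l, T.IsQuotientIso l (K (l + 1)) (W (l + 1))) (p : ∀ l, V (l + 1) → ℂ) :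
    ∀ l, ℕ → V l → ℂ
  -- A default value: level 0 has no blocks.
  | 0, _ => 0
  | l + 1, 0 => p l
  | l + 1, j + 1 => fun x => decompDet T K W h p l j (T.projV (h l) x)

variable {T : RepTower V} {W : ∀ l, Submodule ℂ (V l)} {K : ∀ l, Subgroup (T.G l)}

theorem isNonreducedBlockDecomposition_decomp
    (h_equidim : ∀ l, (T.rep (l + 1)).IsEquidimensional)
    (h_invariant : ∀ l, (T.rep (l + 1)).IsInvariant (W (l + 1)))
    (h_component : ∀ l, (T.G (l + 1)).IsIdentityComponent (K (l + 1))
      ((T.rep (l + 1)).kernelMod (W (l + 1))))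
    (h_dim : ∀ l, (T.G (l + 1)).dim (K (l + 1)) = Module.finrank ℂ (W (l + 1)))
    (h_open : ∀ l, (T.rep (l + 1)).HasRelativelyOpenOrbit (K (l + 1)) ⊥ (W (l + 1)))
    (h_iso : ∀ l, T.IsQuotientIso l (K (l + 1)) (W (l + 1)))
    {p : ∀ l, V (l + 1) → ℂ}
    (hp : ∀ l, (T.rep (l + 1)).IsRelCoeffDet ⊥ (K (l + 1)) ⊥ (W (l + 1)) (p l))
    (hp' : ∀ l, p l ≠ 0) (l : ℕ) :
    (T.rep l).IsNonreducedBlockDecomposition l (T.decompW K W h_iso l) (T.decompK K W h_iso l)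
      (T.decompDet K W h_iso p l) := by
  induction l with
  | zero => exact T.isNonreducedBlockDecomposition_zero ⊥
  | succ l ih =>
    let X := T.splitExtension (h_iso l) (h_component l).le (h_invariant l)
    have hdet : T.decompDet K W h_iso p (l + 1) = X.extendDet (p l) (T.decompDet K W h_iso p l) :=
      funext fun j => by cases j <;> rfl
    rw [hdet]
    refine X.isNonreducedBlockDecomposition (h_component l) (h_equidim l) (h_dim l)
      (h_open l) (h_iso l).normal (hp l) (hp' l) ih ?_ rfl rfl (fun _ => rfl) rfl rfl fun _ => rfl
    -- At level 1 the bottom block is the whole of `G 1`: since `G 0` is trivial, the projection has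
    -- kernel everything.
    rintro rfl
    have := T.G_zero
    exact eq_top_iff.2 fun g _ => X.mem_K.2 (Subsingleton.elim _ _)

theorem finite_decompK_zero
    (h_iso : ∀ l, T.IsQuotientIso l (K (l + 1)) (W (l + 1)))
    {p : ∀ l, V (l + 1) → ℂ}
    (hp : ∀ l, (T.rep (l + 1)).IsRelCoeffDet ⊥ (K (l + 1)) ⊥ (W (l + 1)) (p l))
    (hp' : ∀ l, p l ≠ 0) : ∀ l, Finite (T.decompK K W h_iso l 0)
  | 0 => inferInstanceAs (Finite (⊥ : Subgroup (T.G 0)))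
  | l + 1 => LinearAlgebraicGroup.finite_of_lie_eq_bot ((hp l).lie_kernelMod_bot_inf (hp' l))

theorem isReducedGerm_decompDet
    (h_invariant : ∀ l, (T.rep (l + 1)).IsInvariant (W (l + 1)))
    (h_component : ∀ l, (T.G (l + 1)).IsIdentityComponent (K (l + 1))
      ((T.rep (l + 1)).kernelMod (W (l + 1))))
    (h_iso : ∀ l, T.IsQuotientIso l (K (l + 1)) (W (l + 1)))
    {p : ∀ l, V (l + 1) → ℂ} (hred : ∀ l, IsReducedGerm (p l)) :
    ∀ l, ∀ j < l, IsReducedGerm (T.decompDet K W h_iso p l j)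
  | l + 1, 0, _ => hred l
  | l + 1, j + 1, hj =>
    (isReducedGerm_decompDet h_invariant h_component h_iso hred l j
      (Nat.lt_of_succ_lt_succ hj)).comp_linearMap
      (T.splitExtension (h_iso l) (h_component l).le (h_invariant l)).projV_incV

/-- The relative coefficient determinants divide the coefficient determinant. -/
theorem germDvd_decompDet
    (h_invariant : ∀ l, (T.rep (l + 1)).IsInvariant (W (l + 1)))
    (h_component : ∀ l, (T.G (l + 1)).IsIdentityComponent (K (l + 1))
      ((T.rep (l + 1)).kernelMod (W (l + 1))))
    (h_iso : ∀ l, T.IsQuotientIso l (K (l + 1)) (W (l + 1)))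
    {p : ∀ l, V (l + 1) → ℂ} {q : ∀ l, V l → ℂ}
    (hp : ∀ l, (T.rep (l + 1)).IsRelCoeffDet ⊥ (K (l + 1)) ⊥ (W (l + 1)) (p l))
    (hq : ∀ l, (T.rep l).IsCoeffDet (q l))
    (hrel : ∀ l, AreRelPrimeGerms (p l) fun x => q l (T.projV (h_iso l) x)) :
    ∀ l, ∀ j < l, GermDvd (T.decompDet K W h_iso p l j) (q l) := by
  intro l
  induction l with
  | zero => exact fun j hj => absurd hj (Nat.not_lt_zero j)
  | succ l ih =>
    let X := T.splitExtension (h_iso l) (h_component l).le (h_invariant l)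
    -- Up to `c`, the coefficient determinant at level `l + 1` is `p l` times the pullback of `q l`.
    -- The bottom determinant divides the first factor, and the older ones divide the second by
    -- induction.
    obtain ⟨c, hc⟩ := (X.isCoeffDet_mul (hp l) (hq l)).eq_const_mul (hq (l + 1))
    rw [funext hc]
    rintro (_ | j) hj
    · exact (hrel l).germDvd_left c
    · exact ((ih j (Nat.lt_of_succ_lt_succ hj)).comp_linearMap X.projV).trans_relPrime (hrel l) c

/-- The new determinant is prime to the pullback of `q l`, hence to its divisors, among them the
older determinants. Those stay prime to each other under pullback along the split projection. -/
theorem areRelPrimeGerms_decompDet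
    (h_invariant : ∀ l, (T.rep (l + 1)).IsInvariant (W (l + 1)))
    (h_component : ∀ l, (T.G (l + 1)).IsIdentityComponent (K (l + 1))
      ((T.rep (l + 1)).kernelMod (W (l + 1))))
    (h_iso : ∀ l, T.IsQuotientIso l (K (l + 1)) (W (l + 1)))
    {p : ∀ l, V (l + 1) → ℂ} {q : ∀ l, V l → ℂ}
    (hp : ∀ l, (T.rep (l + 1)).IsRelCoeffDet ⊥ (K (l + 1)) ⊥ (W (l + 1)) (p l))
    (hq : ∀ l, (T.rep l).IsCoeffDet (q l))
    (hrel : ∀ l, AreRelPrimeGerms (p l) fun x => q l (T.projV (h_iso l) x)) :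
    ∀ l, ∀ i < l, ∀ j < l, i ≠ j →
      AreRelPrimeGerms (T.decompDet K W h_iso p l i) (T.decompDet K W h_iso p l j) := by
  intro l
  induction l with
  | zero => exact fun i hi => absurd hi (Nat.not_lt_zero i)
  | succ l ih =>
    let X := T.splitExtension (h_iso l) (h_component l).le (h_invariant l)
    have key : ∀ j < l, AreRelPrimeGerms (p l)
        fun x => T.decompDet K W h_iso p l j (T.projV (h_iso l) x) := fun j hj =>
      (hrel l).of_germDvd
        ((germDvd_decompDet h_invariant h_component h_iso hp hq hrel l j hj).comp_linearMap X.projV)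
    rintro (_ | i) hi (_ | j) hj hij
    · exact absurd rfl hij
    · exact key j (Nat.lt_of_succ_lt_succ hj)
    · exact (key i (Nat.lt_of_succ_lt_succ hi)).symm
    · exact (ih i (Nat.lt_of_succ_lt_succ hi) j (Nat.lt_of_succ_lt_succ hj)
        fun h => hij (congrArg _ h)).comp_linearMap X.projV_incV

end RepTower

end

/-! ### The proposition -/

theorem proposition4p4
    (V : ℕ → Type*) [∀ l, NormedAddCommGroup (V l)] [∀ l, NormedSpace ℂ (V l)]
    [∀ l, FiniteDimensional ℂ (V l)] (T : RepTower V)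
    (W : ∀ l, Submodule ℂ (V l)) (K : ∀ l, Subgroup (T.G l))
    (h_equidim : ∀ l, (T.rep (l + 1)).IsEquidimensional)
    (h_invariant : ∀ l, (T.rep (l + 1)).IsInvariant (W (l + 1)))
    (h_component : ∀ l, (T.G (l + 1)).IsIdentityComponent (K (l + 1))
      ((T.rep (l + 1)).kernelMod (W (l + 1))))
    (h_dim : ∀ l, (T.G (l + 1)).dim (K (l + 1)) = Module.finrank ℂ (W (l + 1)))
    (h_open : ∀ l, (T.rep (l + 1)).HasRelativelyOpenOrbit (K (l + 1)) ⊥ (W (l + 1)))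
    (h_iso : ∀ l, T.IsQuotientIso l (K (l + 1)) (W (l + 1))) :
    ((T.rep 1).IsBlockRep →
      (∀ l, ∃ (p : V (l + 1) → ℂ) (q : V l → ℂ),
        (T.rep (l + 1)).IsRelCoeffDet ⊥ (K (l + 1)) ⊥ (W (l + 1)) p ∧
        (T.rep l).IsCoeffDet q ∧
        IsReducedGerm p ∧ AreRelPrimeGerms p (fun x => q (T.projV (h_iso l) x))) →
      T.IsBlockStructure (fun l => l) (T.decompW K W h_iso) (T.decompK K W h_iso)) ∧
    ((T.rep 1).IsNonreducedBlockRep →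
      T.IsNonreducedBlockStructure (fun l => l) (T.decompW K W h_iso)
        (T.decompK K W h_iso)) := by
  constructor
  · intro _ h
    choose p q hp hq hred hrel using h
    have hp' := fun l => (hred l).ne_zero
    have hdec : ∀ l, (T.rep l).IsBlockDecomposition l (T.decompW K W h_iso l)
        (T.decompK K W h_iso l) (T.decompDet K W h_iso p l) := fun l =>
      { RepTower.isNonreducedBlockDecomposition_decomp h_equidim h_invariant h_component h_dim
          h_open h_iso hp hp' l with
        reduced := RepTower.isReducedGerm_decompDet h_invariant h_component h_iso hred l
        relPrime := RepTower.areRelPrimeGerms_decompDet h_invariant h_component h_iso hp hq hrel l }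
    exact
      -- Passing to the full kernels keeps the determinants, so the same `p` witnesses both
      -- structures.
      { blockRep := fun l => ⟨_, (hdec l).kernelMod⟩
        decomposition := fun l => ⟨_, hdec l⟩
        K_zero_finite := RepTower.finite_decompK_zero h_iso hp hp'
        one_le := fun l => Nat.le_add_left 1 l
        quotientIso := h_iso }
  · intro _
    -- Without reducedness, the open orbit alone provides a nonzero relative determinant.
    choose p hp hp' using fun l => RationalRep.exists_isRelCoeffDet_ne_zero (h_component l).le
      (h_dim l) (h_open l)
    have hdec := RepTower.isNonreducedBlockDecomposition_decomp h_equidim h_invariant h_component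
      h_dim h_open h_iso hp hp'
    exact
      { blockRep := fun l => ⟨_, (hdec l).kernelMod⟩
        decomposition := fun l => ⟨_, hdec l⟩
        K_zero_finite := RepTower.finite_decompK_zero h_iso hp hp'
        one_le := fun l => Nat.le_add_left 1 l
        quotientIso := h_iso }
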